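/- **Setting.** Let $Q$ be a finite acyclic quiver with vertices $0,1,\dots,\rho$ ($\rho\ge 1$) and $n_{ij}$ arrows from $i$ to $j$, where $n_{ij}=0$ if $i\ge j$ and $0$ is the unique source. Let $r=(r_0,\dots,r_\rho)\in\mathbb N^{\rho+1}$ with $r_0=1$, put $s_i=\sum_{a:\,t(a)=i} r_{s(a)}$, and assume $r_i\le s_i$ for $i\ge 1$. Let $\tilde s_i$ be the number of paths from $0$ to $i$ and $k_i=\tilde s_i-r_i$. Assume that $Q$ is *Y-shaped*: vertex $1$ has at most two arrows out, every other non-source vertex has at most one arrow out, every vertex has at most one arrow in whose source is not $0$, and there is a path $1\to j$ for every $j>1$. Number the arrows out of $1$ (injectively) as $a_1,a_2$, and let $S_b'$ be the set of vertices $j>1$ such that the path $1\to j$ contains $a_b$ (empty if there is no arrow $a_b$); thus $\{2,\dots,\rho\}=S_1'\sqcup S_2'$. **Matrices.** For $i\ge1$ let $A_i$ be the $k_i\times\tilde s_i$ matrix constructed recursively as follows. It has one column for each arrow $0\to i$ and $\tilde s_p$ columns for each arrow $a:p\to i$ with $p\ne0$; it has $s_i-r_i$ new rows and $k_p$ rows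 for each such arrow $a$. The new rows consist of new variables $x^{(i)}_{j,k}$ ($1\le j\le s_i-r_i$, $1\le k\le \tilde s_i$). The rows belonging to $a$ are zero outside the columns belonging to $a$, and in those columns form a copy of $A_p$. The columns are ordered (and numbered by $k$) as follows: the columns belonging to arrows $0\to i$ come, in a fixed order, before the columns inherited from $A_p$ if $i\in S_1'$, and after them if $i\in S_2'$. **Monomial order.** Use the lexicographic monomial order on $\mathbb C[x^{(i)}_{j,k}]$ for the following order of the variables. Variables introduced in $A_i$ are larger than those introduced in $A_1$, which are larger than those introduced in $A_{j}$, for $i\in S_1'$, $j\in S_2'$. If $i<j$ are both in $S_1'$, the variables introduced in $A_j$ are larger than those introduced in $A_i$; if $i<j$ are both in $S_2'$, the variables introduced in $A_i$ are larger than those introduced in $A_j$. For fixed $i$, $x^{(i)}_{1,1}>x^{(i)}_{1,2}>\dots>x^{(i)}_{s_i-r_i,\tilde s_i}$ (row by row, from left to right). **Tableaux.** Order all columns occurring in the $A_i$, i.e. all arrows $0\to v$, in one list: first those with $v\in S_1'$, larger $v$ first, then those with $v=1$, then those with $v\in S_2'$, smaller $v$ first (for equal $v$ in the fixed order); this induces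 the above column order of each $A_i$. List the pairs $(i,j)$ with $i\ge 1$, $1\le j\le s_i-r_i$ from top to bottom: first $i\in S_1'$ in decreasing order, then $i=1$, then $i\in S_2'$ in increasing order, and for fixed $i$ by increasing $j$. A tableau of appropriate shape has one (possibly empty) row for each pair $(i,j)$, of a length $\lambda_i$ depending only on $i$, where $\lambda_j\le\lambda_i$ whenever there is an arrow $i\to j$ with $i\neq0$, and $\lambda_i+\lambda_j\le\lambda_1$ for $i\in S_1'$, $j\in S_2'$. The rows with $i\in S_1'$ begin after $\lambda_1-\lambda_i$ empty places; all other rows begin at the left margin. The boxes of row $(i,j)$ are filled with columns of $A_i$. The tableau is semi-standard if its entries increase weakly along rows and strictly down columns. Its monomial is the product of $x^{(i)}_{j,c}$ over all boxes, where the box lies in row $(i,j)$ and has entry $c$. **Theorem.** Let $B\subseteq\mathbb C[x^{(i)}_{j,k}]$ be the subalgebra generated by the $k_i\times k_i$ minors of the matrices $A_i$, $i=1,\dots,\rho$. Then these minors form a SAGBI basis of $B$ for the above monomial order: the initial terms of the minors generate the initial algebra of $B$, that is, the algebra generated by the initial terms of all elements of $B$. Moreover, the initial algebra of $B$ is the $\mathbb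 C$-linear span of the monomials of the semi-standard skew Young tableaux of appropriate shapes. -/

import Mathlib

/-- The data of a quiver flag variety `M(Q, r)`: a finite acyclic quiver on the vertices
`0, …, ρ`, ordered so that arrows go from smaller to larger vertices, with unique source `0`,
together with a dimension vector `r` with `r 0 = 1` and `r i ≤ s i` (non-emptiness of `M(Q, r)`).
The arrows from `i` to `j` are the elements of `Fin (n i j)`. -/
structure FlagQuiver (ρ : ℕ) where
  /-- `n i j` is the number of arrows from `i` to `j`. -/
  n : Fin (ρ + 1) → Fin (ρ + 1) → ℕ
  n_eq_zero : ∀ i j, j ≤ i → n i j = 0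
  exists_arrow : ∀ j, j ≠ 0 → ∃ i, 0 < n i j
  /-- The dimension vector. -/
  r : Fin (ρ + 1) → ℕ
  r_zero : r 0 = 1
  r_le : ∀ i, i ≠ 0 → r i ≤ ∑ j, n j i * r j

namespace FlagQuiver

variable {ρ : ℕ} (Q : FlagQuiver ρ)

/-- `s i` is the sum of `r (source a)` over all arrows `a` into `i`. -/
def s (i : Fin (ρ + 1)) : ℕ := ∑ j, Q.n j i * Q.r j

/-- The columns of the matrix `A i` (for `i ≠ 0`): one column for each arrow `0 → i`, and
a copy of the columns of `A i` for each arrow `i → j` with `i ≠ 0` among the columns of `A j`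
(there are no columns at vertex `0`). Equivalently, these are the paths from `0` to `i`. -/
inductive Col : Fin (ρ + 1) → Type
  | root {i : Fin (ρ + 1)} (a : Fin (Q.n 0 i)) : Col i
  | ext {i j : Fin (ρ + 1)} (a : Fin (Q.n i j)) (c : Col i) : Col j

/-- The rows of the matrix `A i` (for `i ≠ 0`): `s i - r i` new rows, and a copy of the rows of
`A i` for each arrow `i → j` with `i ≠ 0` among the rows of `A j` (there are no rows at
vertex `0`, because `s 0 - r 0 = 0`). -/
inductive Row : Fin (ρ + 1) → Type
  | new {i : Fin (ρ + 1)} (j : Fin (Q.s i - Q.r i)) : Row i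
  | ext {i j : Fin (ρ + 1)} (a : Fin (Q.n i j)) (w : Row i) : Row j

/-- The coordinates `x^(i)_{j,k}`, where `j` runs over the `s i - r i` new rows and `k` over the
columns of `A i`. -/
structure Var where
  vertex : Fin (ρ + 1)
  row : Fin (Q.s vertex - Q.r vertex)
  col : Q.Col vertex

/-- The entries of the matrices `A i`. A new row consists of new variables. The rows of `A j` that
belong to an arrow `a : i → j` with `i ≠ 0` vanish outside the columns that belong to `a`, and in
those columns they form a copy of `A i`. -/
noncomputable def entry : {i : Fin (ρ + 1)} → Q.Row i → Q.Col i → MvPolynomial Q.Var ℂ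
  | i, .new j, c => MvPolynomial.X ⟨i, j, c⟩
  | _, .ext _ _, .root _ => 0
  | _, .ext (i := i) a w, .ext (i := i') a' c =>
      if h : i' = i then
        if h ▸ a' = a then entry w (h ▸ c) else 0
      else 0

/-- The matrix `A i`. -/
noncomputable def A (i : Fin (ρ + 1)) : Matrix (Q.Row i) (Q.Col i) (MvPolynomial Q.Var ℂ) :=
  Matrix.of fun w c => Q.entry w c

/-- `sTilde i = dim H⁰(W i)` is the number of paths from `0` to `i`, i.e. the number of columns
of `A i`, for `i ≠ 0`. -/
noncomputable def sTilde (i : Fin (ρ + 1)) : ℕ := Nat.card (Q.Col i)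

/-- `k i = sTilde i - r i` is the number of rows of `A i`, for `i ≠ 0`. -/
noncomputable def k (i : Fin (ρ + 1)) : ℕ := Q.sTilde i - Q.r i

/-- The `k i × k i` minors of the matrices `A i`, for `i = 1, …, ρ`. Rows and columns are listed
in any order, so that each minor occurs together with its negative. -/
def minors : Set (MvPolynomial Q.Var ℂ) :=
  {f | ∃ i, i ≠ 0 ∧ ∃ (u : Fin (Q.k i) ↪ Q.Row i) (v : Fin (Q.k i) ↪ Q.Col i),
    f = ((Q.A i).submatrix u v).det}

/-- The quiver is Y-shaped: vertex `1` has at most two arrows out, all other non-source vertices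
have at most one arrow out, every vertex has at most one arrow in whose source is not `0`, and
every vertex `j > 1` can be reached from `1`. -/
structure IsYShaped : Prop where
  pos : 0 < ρ
  out_one : ∑ j, Q.n 1 j ≤ 2
  out_le : ∀ i, 1 < i → ∑ j, Q.n i j ≤ 1
  in_le : ∀ j, ∑ i ∈ Finset.univ.erase 0, Q.n i j ≤ 1
  reach : ∀ j, 1 < j → Relation.TransGen (fun u v => 0 < Q.n u v) 1 j

/-- A numbering of the arrows out of vertex `1` as `a₁` (number `0`) and `a₂` (number `1`). If
there are fewer than two such arrows, the missing branches are empty. -/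
abbrev BranchNumbering : Type := (Σ j, Fin (Q.n 1 j)) ↪ Fin 2

variable {Q}

/-- The vertices that can be reached from `1` by a path through the arrow with number `b`:
`branch e 0` is `S₁'` and `branch e 1` is `S₂'`. -/
def branch (e : Q.BranchNumbering) (b : Fin 2) : Set (Fin (ρ + 1)) :=
  {i | ∃ (j : Fin (ρ + 1)) (a : Fin (Q.n 1 j)), e ⟨j, a⟩ = b ∧
    Relation.ReflTransGen (fun u v => 0 < Q.n u v) j i}

open Classical in
/-- The position of a vertex `i ≥ 1`: first the vertices of `S₁'` in decreasing order, then
vertex `1`, then the vertices of `S₂'` in increasing order. -/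
noncomputable def pos (e : Q.BranchNumbering) (i : Fin (ρ + 1)) : ℤ :=
  if i ∈ branch e 0 then -(i : ℤ) else (i : ℤ)

/-- The vertex and the number of the arrow out of `0` from which a column stems. -/
def Col.start : {i : Fin (ρ + 1)} → Q.Col i → Fin (ρ + 1) × ℕ
  | i, .root a => (i, a)
  | _, .ext _ c => c.start

/-- The common numbering of the columns of all matrices `A i`, as an element of a linearly ordered
set: columns are ordered by the position of the vertex `v` in the first arrow `0 → v` from which
they stem, and then by the number of that arrow. So, for `i` in `S₁'`, the columns of `A i` that
belong to arrows `0 → i` come before the columns inherited from the previous matrix; for `i` in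
`S₂'` they come after them. -/
noncomputable def Col.key (e : Q.BranchNumbering) {i : Fin (ρ + 1)} (c : Q.Col i) : ℤ ×ₗ ℕ :=
  toLex (pos e c.start.1, c.start.2)

/-- The priority of a variable: first by the position of the vertex at which it is introduced,
then by its row, then by its column. -/
noncomputable def Var.key (e : Q.BranchNumbering) (x : Q.Var) : ℤ ×ₗ ℕ ×ₗ ℤ ×ₗ ℕ :=
  toLex (pos e x.vertex, toLex ((x.row : ℕ), x.col.key e))

theorem pos_injective (e : Q.BranchNumbering) :
    Function.Injective (pos e) := by
  have h0 : (0 : Fin (ρ + 1)) ∉ branch e 0 := by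
    rintro ⟨j, a, -, hj⟩
    have hne : j ≠ 0 := by
      rintro rfl
      have := Q.n_eq_zero 1 0 (Fin.zero_le _)
      exact (Nat.ne_of_gt a.pos) this
    rcases Relation.ReflTransGen.cases_tail hj with h1 | ⟨b, -, hb⟩
    · exact hne h1.symm
    · exact (Nat.ne_of_gt hb) (Q.n_eq_zero b 0 (Fin.zero_le _))
  intro i j hij
  unfold pos at hij
  have hi : i ∈ branch e 0 → (i : ℕ) ≠ 0 := fun hi hz => h0 ((Fin.ext hz : i = 0) ▸ hi)
  have hj : j ∈ branch e 0 → (j : ℕ) ≠ 0 := fun hj hz => h0 ((Fin.ext hz : j = 0) ▸ hj)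
  apply Fin.ext
  split_ifs at hij with h1 h2 h2
  · omega
  · have := hi h1; omega
  · have := hj h2; omega
  · omega

theorem Col.start_le {i : Fin (ρ + 1)} (c : Q.Col i) : c.start.1 ≤ i := by
  induction c with
  | root a => exact le_rfl
  | @ext i j a c ih =>
    have hij : i < j := not_le.mp fun hle => (Nat.ne_of_gt a.pos) (Q.n_eq_zero i j hle)
    exact ih.trans hij.le

theorem Col.ne_zero {i : Fin (ρ + 1)} (c : Q.Col i) : i ≠ 0 := by
  rintro rfl
  cases c with
  | root a => exact (Nat.ne_of_gt a.pos) (Q.n_eq_zero 0 0 le_rfl)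
  | ext a c => exact (Nat.ne_of_gt a.pos) (Q.n_eq_zero _ 0 (Fin.zero_le _))

theorem IsYShaped.unique_in (h : IsYShaped Q) {i i' j : Fin (ρ + 1)} (hi : i ≠ 0) (hi' : i' ≠ 0)
    (a : Fin (Q.n i j)) (a' : Fin (Q.n i' j)) : i = i' ∧ HEq a a' := by
  have hsum := h.in_le j
  have hle : ∀ u, u ≠ 0 → Q.n u j ≤ 1 := fun u hu =>
    (Finset.single_le_sum (f := fun u => Q.n u j) (fun _ _ => Nat.zero_le _)
      (Finset.mem_erase.mpr ⟨hu, Finset.mem_univ u⟩)).trans hsum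
  have hii : i = i' := by
    by_contra hne
    have h2 : ∑ u ∈ ({i, i'} : Finset (Fin (ρ + 1))), Q.n u j ≤ 1 := by
      refine (Finset.sum_le_sum_of_subset ?_).trans hsum
      intro u hu
      simp only [Finset.mem_insert, Finset.mem_singleton] at hu
      rcases hu with rfl | rfl <;> simp [hi, hi']
    rw [Finset.sum_pair hne] at h2
    have := a.pos
    have := a'.pos
    omega
  subst hii
  refine ⟨rfl, heq_of_eq (Fin.ext ?_)⟩
  have := hle i hi
  omega

theorem Col.start_injective (h : IsYShaped Q) {i : Fin (ρ + 1)} (c c' : Q.Col i)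
    (hc : c.start = c'.start) : c = c' := by
  have key : ∀ {i j : Fin (ρ + 1)} (a : Fin (Q.n i j)) (c : Q.Col i) (b : Fin (Q.n 0 j)),
      (Col.ext a c).start ≠ (Col.root b).start := by
    intro i j a c b heq
    have hij : i < j := not_le.mp fun hle => (Nat.ne_of_gt a.pos) (Q.n_eq_zero i j hle)
    have h1 : c.start.1 = j := congrArg Prod.fst heq
    exact absurd (h1 ▸ c.start_le) (not_le.mpr hij)
  induction c with
  | root a =>
    cases c' with
    | root a' =>
      have : (a : ℕ) = a' := congrArg Prod.snd hc
      rw [Fin.ext this]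
    | ext a' c' => exact absurd hc.symm (key a' c' a)
  | ext a c ih =>
    cases c' with
    | root a' => exact absurd hc (key a c a')
    | ext a' c' =>
      obtain ⟨rfl, ha⟩ := h.unique_in c.ne_zero c'.ne_zero a a'
      obtain rfl := eq_of_heq ha
      rw [ih c' hc]

theorem Col.key_injective (h : IsYShaped Q) (e : Q.BranchNumbering) {i : Fin (ρ + 1)}
    (c c' : Q.Col i) (hc : c.key e = c'.key e) : c = c' := by
  have h1 : (pos e c.start.1, c.start.2) = (pos e c'.start.1, c'.start.2) := toLex.injective hc
  obtain ⟨h2, h3⟩ := Prod.mk.inj h1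
  exact Col.start_injective h c c' (Prod.ext (pos_injective e h2) h3)

theorem Var.key_injective (h : IsYShaped Q) (e : Q.BranchNumbering) :
    Function.Injective (Var.key e : Q.Var → _) := by
  rintro ⟨i, j, c⟩ ⟨i', j', c'⟩ hx
  have h1 := toLex.injective hx
  obtain rfl : i = i' := pos_injective e (congrArg Prod.fst h1)
  have h2 := toLex.injective (congrArg Prod.snd h1)
  obtain rfl : j = j' := Fin.ext (congrArg Prod.fst h2)
  obtain rfl : c = c' := Col.key_injective h e c c' (congrArg Prod.snd h2)
  rfl

instance Col.instFinite (j : Fin (ρ + 1)) : Finite (Q.Col j) := by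
  induction j using WellFoundedLT.induction with
  | ind j ih =>
    have : ∀ i : {i : Fin (ρ + 1) // i < j}, Finite (Q.Col i.1) := fun i => ih i.1 i.2
    let g : Fin (Q.n 0 j) ⊕ (Σ i : {i : Fin (ρ + 1) // i < j}, Fin (Q.n i.1 j) × Q.Col i.1) →
        Q.Col j := Sum.elim Col.root fun p => Col.ext p.2.1 p.2.2
    refine Finite.of_surjective g fun c => ?_
    cases c with
    | root a => exact ⟨Sum.inl a, rfl⟩
    | @ext i _ a c =>
      have hij : i < j := not_le.mp fun hle => (Nat.ne_of_gt a.pos) (Q.n_eq_zero i j hle)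
      exact ⟨Sum.inr ⟨⟨i, hij⟩, a, c⟩, rfl⟩

instance Var.instFinite : Finite Q.Var := by
  let g : (Σ i : Fin (ρ + 1), Fin (Q.s i - Q.r i) × Q.Col i) → Q.Var :=
    fun p => ⟨p.1, p.2.1, p.2.2⟩
  exact Finite.of_surjective g fun x => ⟨⟨x.vertex, x.row, x.col⟩, rfl⟩

/-- The lexicographic monomial order in which `x > y` for two variables if the key of `x`
is smaller than the key of `y`. -/
noncomputable def monomialOrder (h : IsYShaped Q) (e : Q.BranchNumbering) :
    MonomialOrder Q.Var :=
  letI : LinearOrder Q.Var := LinearOrder.lift' (Var.key e) (Var.key_injective h e)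
  MonomialOrder.lex

open Classical in
/-- The number of empty boxes at the beginning of the rows that belong to the vertex `i`, in a
tableau with row lengths `len`: the rows that belong to `S₁'` are aligned on the right with the
rows of vertex `1`, all other rows are aligned on the left. -/
noncomputable def offset (e : Q.BranchNumbering) (len : Fin (ρ + 1) → ℕ) (i : Fin (ρ + 1)) : ℕ :=
  if i ∈ branch e 0 then len 1 - len i else 0

/-- Semi-standard skew Young tableaux of the shapes attached to a Y-shaped quiver. There is one
row for each vertex `i ≥ 1` and each `j < s i - r i`; the rows are listed from top to bottom by the
position of `i` and then by `j`. All rows that belong to `i` have the same length `len i`. The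
`q`-th box of such a row lies in column `offset e len i + q`. The entries of the rows of `i` are
columns of `A i`, compared by their common numbering. -/
structure Tableau (e : Q.BranchNumbering) where
  len : Fin (ρ + 1) → ℕ
  /-- Row lengths decrease weakly along both branches. -/
  len_le : ∀ i j, i ≠ 0 → 0 < Q.n i j → len j ≤ len i
  /-- No column of the tableau meets both branches. -/
  len_add_le : ∀ i ∈ branch e 0, ∀ j ∈ branch e 1, len i + len j ≤ len 1
  /-- `fill i j q` is the entry in the `q`-th box of the `j`-th row that belongs to `i`. -/
  fill : (i : Fin (ρ + 1)) → Fin (Q.s i - Q.r i) → Fin (len i) → Q.Col i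
  /-- Entries increase weakly along rows. -/
  row_weak : ∀ i j q q', q ≤ q' → (fill i j q).key e ≤ (fill i j q').key e
  /-- Entries increase strictly down columns. -/
  col_strict : ∀ i (j : Fin (Q.s i - Q.r i)) (q : Fin (len i))
    i' (j' : Fin (Q.s i' - Q.r i')) (q' : Fin (len i')),
    (toLex (pos e i, (j : ℕ)) : ℤ ×ₗ ℕ) < toLex (pos e i', (j' : ℕ)) →
    offset e len i + (q : ℕ) = offset e len i' + (q' : ℕ) →
    (fill i j q).key e < (fill i' j' q').key e

/-- The monomial of a tableau: the product of the variables `x^(i)_{j,c}` over all boxes, where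
the box lies in the `j`-th row that belongs to `i` and has the entry `c`. -/
noncomputable def Tableau.monomial {e : Q.BranchNumbering} (T : Tableau e) :
    MvPolynomial Q.Var ℂ :=
  ∏ i, ∏ j, ∏ q, MvPolynomial.X ⟨i, j, T.fill i j q⟩

end FlagQuiver

/-- The initial algebra of a subalgebra `B` of a polynomial ring: the subalgebra generated by the
initial terms of the elements of `B`. -/
noncomputable def initialAlgebra {σ K : Type*} [Field K] (m : MonomialOrder σ)
    (B : Subalgebra K (MvPolynomial σ K)) : Subalgebra K (MvPolynomial σ K) :=
  Algebra.adjoin K (m.leadingTerm '' (B : Set (MvPolynomial σ K)))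

/-- `G` is a SAGBI basis of the subalgebra `B`: it is a subset of `B`, and the initial terms of
its elements generate the initial algebra of `B`. -/
def IsSagbiBasis {σ K : Type*} [Field K] (m : MonomialOrder σ) (G : Set (MvPolynomial σ K))
    (B : Subalgebra K (MvPolynomial σ K)) : Prop :=
  G ⊆ B ∧ Algebra.adjoin K (m.leadingTerm '' G) = initialAlgebra m B

/-! Let `B` be the algebra generated by the minors. Three inclusions form a cycle: the span of the
tableau monomials lies in the algebra generated by the initial terms of the minors, which lies in
the initial algebra of `B`, which lies in the span of the tableau monomials.

For the first inclusion, a column of a tableau meets exactly the rows of a single matrix `A t`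
(`Tableau.exists_meets_iff_reach`). As its entries increase strictly, its monomial is the diagonal
term of a minor of `A t`, and this is the initial term (`leadingTerm_det`). The second inclusion is
trivial.

The last inclusion needs no straightening law. A minor of `A t` involves all rows of `A t`, so `B`
is fixed pointwise by adding a multiple of the row `(i, p)` to another row `(j, q)` whenever there
is a path from `i` to `j` (`rowShift_eq_of_mem_adjoin`). If `f` is invariant under `y c ↦ y c + t *
x c`, the substitution `y c = x c * Y c` turns it into a family of polynomials in `Y` invariant
under translating all `Y c` by the same `t`. A degree argument shows that lexicographically extremal
exponents of such polynomials satisfy a ballot condition (`ballot_of_natDegree_translation_le` for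
minima, `ballot_of_translation_eq` for maxima).

For the initial monomial of a row-homogeneous `f`, the ballot condition bounds the number of entries
up to a given column in the lower row by the number of strictly smaller entries in the upper row.
Once the rows are sorted, this is strict increase down the columns. Outside the first branch one
counts from the left, as rows are left-aligned and new columns are added on the right; in the first
branch everything is mirrored. The grading of `B` by row degrees provides the row lengths. -/

/-! ### Translations and degrees in one distinguished variable. -/

open Polynomial in
/-- `p ∈ R[y][t]` has degree at most `a` in `y`, and `P ∈ R[t]` is its coefficient of `y ^ a`. -/
def HasTopCoeff {R : Type*} [CommRing R] (a : ℕ) (p : R[X][X]) (P : R[X]) : Prop :=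
  ∀ i, (p.coeff i).natDegree ≤ a ∧ (p.coeff i).coeff a = P.coeff i

namespace HasTopCoeff

open Polynomial

variable {R : Type*} [CommRing R] {a b : ℕ} {p q : R[X][X]} {P P' : R[X]}

theorem mul (hp : HasTopCoeff a p P) (hq : HasTopCoeff b q P') :
    HasTopCoeff (a + b) (p * q) (P * P') := by
  intro i
  rw [coeff_mul, coeff_mul]
  refine ⟨natDegree_sum_le_of_forall_le _ _ fun x _ =>
    natDegree_mul_le_of_le (hp x.1).1 (hq x.2).1, ?_⟩
  rw [finsetSum_coeff]
  refine Finset.sum_congr rfl fun x _ => ?_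
  rw [coeff_mul_add_eq_of_natDegree_le (hp x.1).1 (hq x.2).1, (hp x.1).2, (hq x.2).2]

theorem sum {ι : Type*} (s : Finset ι) {p : ι → R[X][X]} {P : ι → R[X]}
    (h : ∀ i ∈ s, HasTopCoeff a (p i) (P i)) :
    HasTopCoeff a (∑ i ∈ s, p i) (∑ i ∈ s, P i) := by
  intro i
  rw [finsetSum_coeff, finsetSum_coeff]
  refine ⟨natDegree_sum_le_of_forall_le _ _ fun x hx => (h x hx i).1, ?_⟩
  rw [finsetSum_coeff]
  exact Finset.sum_congr rfl fun x hx => (h x hx i).2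

theorem of_lt (hab : a < b) (hp : HasTopCoeff a p P) : HasTopCoeff b p 0 := fun i =>
  ⟨(hp i).1.trans hab.le, by
    rw [coeff_zero]; exact coeff_eq_zero_of_natDegree_lt ((hp i).1.trans_lt hab)⟩

theorem map_C (P : R[X]) : HasTopCoeff 0 (P.map C) P := fun i => by simp

theorem X_add_C_X : HasTopCoeff 1 (X + C X : R[X][X]) 1 := fun i => by
  rw [coeff_add, coeff_C, coeff_X, coeff_one]
  rcases i with _ | _ | i
  · simpa using natDegree_X_le
  · simp [coeff_one]
  · simp

theorem pow (hp : HasTopCoeff a p P) (n : ℕ) : HasTopCoeff (n * a) (p ^ n) (P ^ n) := by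
  induction n with
  | zero =>
    have := map_C (1 : R[X])
    simpa using this
  | succ n ih =>
    rw [pow_succ, pow_succ, Nat.succ_mul]
    exact ih.mul hp

end HasTopCoeff

namespace Polynomial

variable {R : Type*} [CommRing R]

/-- The extension of a translation `τ : R → R[t]` to `R[y] → R[y][t]` with `y ↦ y + t`. -/
noncomputable def extendTranslation (τ : R →+* R[X]) : R[X] →+* R[X][X] :=
  eval₂RingHom ((mapRingHom C).comp τ) (X + C X)

variable {τ : R →+* R[X]}

theorem extendTranslation_X : extendTranslation τ X = X + C X := by
  simp [extendTranslation]

theorem extendTranslation_C (r : R) : extendTranslation τ (C r) = (τ r).map C := by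
  simp [extendTranslation]

/-- At `t = -y` the variable `y` is sent to `y + t = 0`, so only the constant coefficient of `z`
survives, translated by `-y`. -/
theorem eval_neg_X_extendTranslation (z : R[X]) :
    (extendTranslation τ z).eval (-X) = (τ (z.coeff 0)).comp (-X) := by
  have : (evalRingHom (-X)).comp (extendTranslation τ) =
      (compRingHom (-X)).comp (τ.comp constantCoeff) := by
    refine ringHom_ext (fun r => ?_) ?_
    · simp [extendTranslation_C, eval_map, comp]
    · simp [extendTranslation_X]
  simpa using congrArg (fun g => g z) this

/-- Only `y` itself produces powers of `y`: `(y + t) ^ j` with `j < k` cannot reach `y ^ k`, and `(y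
+ t) ^ k` does so with coefficient `1`. -/
theorem hasTopCoeff_extendTranslation {z : R[X]} {k : ℕ} (hz : z.natDegree ≤ k) :
    HasTopCoeff k (extendTranslation τ z) (τ (z.coeff k)) := by
  have h1 : extendTranslation τ z =
      ∑ j ∈ Finset.range (k + 1), (τ (z.coeff j)).map C * (X + C X) ^ j := by
    conv_lhs => rw [as_sum_range_C_mul_X_pow' z (Nat.lt_succ_of_le hz)]
    simp [extendTranslation_X, extendTranslation_C]
  have h2 : τ (z.coeff k) =
      ∑ j ∈ Finset.range (k + 1), if j = k then τ (z.coeff k) else 0 := by simp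
  rw [h1, h2]
  refine HasTopCoeff.sum _ fun j hj => ?_
  have h3 := (HasTopCoeff.map_C (τ (z.coeff j))).mul (HasTopCoeff.X_add_C_X.pow j)
  split_ifs with hjk
  · subst hjk
    simpa using h3
  · exact h3.of_lt (by simp at hj ⊢; omega)

variable [IsDomain R]

/-- If `z(y + t)` has degree at most `w` in `t`, and `y ^ k` is the lowest power of `y` in `z`,
then `k ≤ w`, and the coefficient of `y ^ k` has degree at most `w - k + (deg z - k)` in `t`. -/
theorem natDegree_translation_coeff_le (hτ : ∀ r, (τ r).eval 0 = r) {z : R[X]} {k δ w : ℕ}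
    (hδ : z.natDegree ≤ δ) (hw : (extendTranslation τ (X ^ k * z)).natDegree ≤ w)
    (h0 : z.coeff 0 ≠ 0) :
    k ≤ w ∧ (τ (z.coeff 0)).natDegree ≤ w - k + δ := by
  set h := extendTranslation τ z with hh
  have hev : h.eval (-X) = (τ (z.coeff 0)).comp (-X) := eval_neg_X_extendTranslation z
  have hne : h ≠ 0 := by
    intro h1
    rw [h1, eval_zero] at hev
    have h2 := congrArg (eval 0) hev
    rw [eval_comp] at h2
    simp [hτ] at h2
    exact h0 h2.symm
  -- The factor `y ^ k` becomes `(y + t) ^ k`, monic of degree `k` in `t`, so `h` has `t`-degree at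
  -- most `w - k`.
  have hdeg : (extendTranslation τ (X ^ k * z)).natDegree = k + h.natDegree := by
    rw [map_mul, map_pow, extendTranslation_X, ((monic_X_add_C _).pow k).natDegree_mul' hne,
      (monic_X_add_C _).natDegree_pow, natDegree_X_add_C, mul_one]
  refine ⟨by omega, ?_⟩
  have h3 : ((τ (z.coeff 0)).comp (-X)).natDegree = (τ (z.coeff 0)).natDegree := by
    rw [natDegree_comp, natDegree_neg, natDegree_X, mul_one]
  -- The degree sought is the `y`-degree of `h(-y)`: each coefficient of `h` contributes at most
  -- `δ`, and the power of `-y` at most `w - k`.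
  rw [← h3, ← hev, eval_eq_sum_range]
  refine natDegree_sum_le_of_forall_le _ _ fun i hi => ?_
  have h4 : (h.coeff i).natDegree ≤ δ := (hasTopCoeff_extendTranslation hδ i).1
  have h5 : ((-X : R[X]) ^ i).natDegree ≤ i := by
    refine natDegree_pow_le.trans ?_
    rw [natDegree_neg, natDegree_X, mul_one]
  have := natDegree_mul_le_of_le h4 h5
  have hi' := Finset.mem_range.mp hi
  omega

end Polynomial

/-! ### Ballot conditions for translation-invariant polynomials. -/

namespace MvPolynomial

section Translation

variable (K : Type*) [CommRing K] (N : ℕ)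

/-- The translation `z(y) ↦ z(y + t)` by the same amount `t` in all variables. -/
noncomputable def translation : MvPolynomial (Fin N) K →+* Polynomial (MvPolynomial (Fin N) K) :=
  eval₂Hom (Polynomial.C.comp C) fun j => Polynomial.C (X j) + Polynomial.X

variable {K N}

theorem eval_zero_translation (z : MvPolynomial (Fin N) K) :
    (translation K N z).eval 0 = z := by
  have : (Polynomial.evalRingHom 0).comp (translation K N) = RingHom.id _ := by
    apply ringHom_ext <;> simp [translation]
  exact congrArg (fun g => g z) this

/-- This permits induction on the number of variables: splitting off the first variable turns the
simultaneous translation into the extension of the translation of the others. -/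
theorem extendTranslation_finSuccEquiv (z : MvPolynomial (Fin (N + 1)) K) :
    Polynomial.extendTranslation (translation K N) (finSuccEquiv K N z) =
      (translation K (N + 1) z).map (finSuccEquiv K N : _ →+* _) := by
  have : (Polynomial.extendTranslation (translation K N)).comp (finSuccEquiv K N : _ →+* _) =
      (Polynomial.mapRingHom (finSuccEquiv K N : _ →+* _)).comp (translation K (N + 1)) := by
    apply ringHom_ext
    · intro r
      have : finSuccEquiv K N (C r) = Polynomial.C (C r) := by
        simp [finSuccEquiv_apply]
      simp [translation, this, Polynomial.extendTranslation_C]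
    · intro j
      refine Fin.cases ?_ (fun j => ?_) j
      · simp [translation, finSuccEquiv_X_zero, Polynomial.extendTranslation_X, add_comm]
      · simp [translation, finSuccEquiv_X_succ, Polynomial.extendTranslation_C]
  exact congrArg (fun g => g z) this

end Translation

variable {K : Type*} [CommRing K]

theorem coeff_tail_finSuccEquiv {N : ℕ} (z : MvPolynomial (Fin (N + 1)) K)
    (b : Fin (N + 1) →₀ ℕ) : coeff b.tail ((finSuccEquiv K N z).coeff (b 0)) = coeff b z := by
  rw [finSuccEquiv_coeff_coeff, Finsupp.cons_tail]

theorem exists_lexMin {N : ℕ} {z : MvPolynomial (Fin N) K} (hz : z ≠ 0) :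
    ∃ b ∈ z.support, ∀ b' ∈ z.support, ∀ c, (∀ j < c, b' j = b j) → b c ≤ b' c := by
  obtain ⟨b, hb, hmin⟩ := Finset.exists_min_image z.support (fun d => toLex d)
    (Finset.nonempty_iff_ne_empty.mpr (mt support_eq_empty.mp hz))
  refine ⟨b, hb, fun b' hb' c hc => ?_⟩
  by_contra hlt
  exact absurd (hmin b' hb') (not_le.mpr (Finsupp.Lex.lt_iff.mpr ⟨c, hc, not_le.mp hlt⟩))

variable [IsDomain K]

/-- Induction on the number of variables. Removing the first variable replaces the bound `w` by `w -
b 0 + (γ 0 - b 0)`, by `Polynomial.natDegree_translation_coeff_le`; that this never requires `w < b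
0` is the ballot condition. Invariance is the case `w = 0`, but the induction needs arbitrary `w`.
-/
theorem ballot_of_natDegree_translation_le {N : ℕ} (z : MvPolynomial (Fin N) K) (γ : Fin N → ℕ)
    (b : Fin N →₀ ℕ) (w : ℕ) (hγ : ∀ b' ∈ z.support, ∀ j, b' j ≤ γ j)
    (hw : (translation K N z).natDegree ≤ w) (hb : b ∈ z.support)
    (hlex : ∀ b' ∈ z.support, ∀ c, (∀ j < c, b' j = b j) → b c ≤ b' c) :
    (∀ c, (∑ j, if j ≤ c then b j else 0) ≤ w + ∑ j, if j < c then γ j - b j else 0) ∧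
      ∑ j, b j ≤ w + ∑ j, (γ j - b j) := by
  induction N generalizing w with
  | zero => exact ⟨fun c => c.elim0, by simp⟩
  | succ N ih =>
    have hmem : ∀ (i : ℕ) (d : Fin N →₀ ℕ), d ∈ ((finSuccEquiv K N z).coeff i).support →
        d.cons i ∈ z.support := fun i d hd => mem_support_coeff_finSuccEquiv.mp hd
    -- By minimality of `b`, the lowest power of the first variable is `b 0`, which can be factored
    -- out.
    have hlow : ∀ i < b 0, (finSuccEquiv K N z).coeff i = 0 := by
      intro i hi
      by_contra hne
      obtain ⟨d, hd⟩ := Finset.nonempty_iff_ne_empty.mpr (mt support_eq_empty.mp hne)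
      have := hlex _ (hmem i d hd) 0 (by simp)
      rw [Finsupp.cons_zero] at this
      omega
    obtain ⟨z', hz'⟩ := Polynomial.X_pow_dvd_iff.mpr hlow
    have hcoeff : ∀ i, z'.coeff i = (finSuccEquiv K N z).coeff (b 0 + i) := fun i => by
      rw [hz', add_comm (b 0) i, Polynomial.coeff_X_pow_mul]
    have htail : b.tail ∈ (z'.coeff 0).support := by
      rw [hcoeff, add_zero, mem_support_iff, coeff_tail_finSuccEquiv]
      exact mem_support_iff.mp hb
    have hdeg : z'.natDegree ≤ γ 0 - b 0 := by
      rw [Polynomial.natDegree_le_iff_coeff_eq_zero]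
      intro i hi
      by_contra hne
      rw [hcoeff] at hne
      obtain ⟨d, hd⟩ := Finset.nonempty_iff_ne_empty.mpr (mt support_eq_empty.mp hne)
      have := hγ _ (hmem _ d hd) 0
      rw [Finsupp.cons_zero] at this
      omega
    have hw' : (Polynomial.extendTranslation (translation K N)
        (Polynomial.X ^ b 0 * z')).natDegree ≤ w := by
      rw [← hz', extendTranslation_finSuccEquiv]
      exact Polynomial.natDegree_map_le.trans hw
    obtain ⟨hkw, hw''⟩ := Polynomial.natDegree_translation_coeff_le eval_zero_translation hdeg hw'
      (fun h => by rw [h] at htail; simp at htail)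
    have hmem' : ∀ d ∈ (z'.coeff 0).support, d.cons (b 0) ∈ z.support := fun d hd =>
      hmem _ d (by rwa [hcoeff, add_zero] at hd)
    obtain ⟨ih1, ih2⟩ := ih (z'.coeff 0) (fun j => γ j.succ) b.tail _
      (fun d hd j => by simpa using hγ _ (hmem' d hd) j.succ) hw'' htail (by
        intro d hd c hc
        have := hlex _ (hmem' d hd) c.succ (fun j hj => by
          induction j using Fin.cases with
          | zero => simp
          | succ j => simpa [Finsupp.tail_apply] using hc j (Fin.succ_lt_succ_iff.mp hj))
        simpa [Finsupp.tail_apply] using this)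
    simp only [Finsupp.tail_apply] at ih1 ih2
    refine ⟨fun c => ?_, ?_⟩
    · induction c using Fin.cases with
      | zero =>
        rw [Fin.sum_univ_succ]
        simp
        omega
      | succ c =>
        rw [Fin.sum_univ_succ, Fin.sum_univ_succ]
        simp only [Fin.succ_le_succ_iff, Fin.succ_lt_succ_iff, Fin.zero_le, if_true,
          Fin.succ_pos]
        have := ih1 c
        omega
    · rw [Fin.sum_univ_succ, Fin.sum_univ_succ]
      omega

/-- For a lexicographic maximum, the top coefficient in the first variable is again invariant, which
gives all inequalities but the one at `0`. That one compares `b` with a lexicographically minimal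
exponent of the constant coefficient, which has the same total degree. -/
theorem ballot_of_translation_eq {N : ℕ} (z : MvPolynomial (Fin N) K) (γ : Fin N → ℕ)
    (b : Fin N →₀ ℕ) (hγ : ∀ b' ∈ z.support, ∀ j, b' j ≤ γ j)
    (hz : translation K N z = Polynomial.C z) (hb : b ∈ z.support)
    (hhom : ∀ b' ∈ z.support, ∑ j, b' j = ∑ j, b j)
    (hlex : ∀ b' ∈ z.support, ∀ c, (∀ j < c, b' j = b j) → b' c ≤ b c) (c : Fin N) :
    (∑ j, if c ≤ j then b j else 0) ≤ ∑ j, if c < j then γ j - b j else 0 := by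
  induction N with
  | zero => exact c.elim0
  | succ N ih =>
    set z' := finSuccEquiv K N z with hz'
    have hmem : ∀ (i : ℕ) (d : Fin N →₀ ℕ), d ∈ (z'.coeff i).support →
        d.cons i ∈ z.support := fun i d hd => mem_support_coeff_finSuccEquiv.mp hd
    have hdeg : z'.natDegree ≤ b 0 := by
      rw [Polynomial.natDegree_le_iff_coeff_eq_zero]
      intro i hi
      by_contra hne
      obtain ⟨d, hd⟩ := Finset.nonempty_iff_ne_empty.mpr (mt support_eq_empty.mp hne)
      have := hlex _ (hmem _ d hd) 0 (by simp)
      rw [Finsupp.cons_zero] at this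
      omega
    have hinv : Polynomial.extendTranslation (translation K N) z' = Polynomial.C z' := by
      rw [hz', extendTranslation_finSuccEquiv, hz, Polynomial.map_C]
      rfl
    have htail : b.tail ∈ (z'.coeff (b 0)).support := by
      rw [mem_support_iff, coeff_tail_finSuccEquiv]
      exact mem_support_iff.mp hb
    induction c using Fin.cases with
    | zero =>
      -- Translating by `t = -y₀` recovers `z` from its part without `y₀`, so the `t`-degree of that
      -- part is the `y₀`-degree of `z`, at most `b 0`.
      have h1 : (translation K N (z'.coeff 0)).comp (-Polynomial.X) = z' := by
        rw [← Polynomial.eval_neg_X_extendTranslation, hinv, Polynomial.eval_C]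
      have h2 : (translation K N (z'.coeff 0)).natDegree ≤ b 0 := by
        rw [← h1, Polynomial.natDegree_comp, Polynomial.natDegree_neg, Polynomial.natDegree_X,
          mul_one] at hdeg
        exact hdeg
      have h3 : z'.coeff 0 ≠ 0 := by
        intro h
        rw [h, map_zero, Polynomial.zero_comp] at h1
        rw [← h1] at htail
        simp at htail
      obtain ⟨d, hd, hmin⟩ := exists_lexMin h3
      have hle : ∀ d ∈ (z'.coeff 0).support, ∀ j, d j ≤ γ j.succ := fun d hd j => by
        simpa using hγ _ (hmem 0 d hd) j.succ
      -- With `∑ d = ∑ b` from homogeneity, `h4` reads `2 * ∑ b ≤ b 0 + ∑ γ`, where the sum of `γ`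
      -- omits the first variable; this rearranges to the claim.
      have h4 := (ballot_of_natDegree_translation_le (z'.coeff 0) (fun j => γ j.succ) d (b 0)
        hle h2 hd hmin).2
      have h5 := hhom _ (hmem 0 d hd)
      rw [Fin.sum_univ_succ, Fin.sum_univ_succ (fun j => b j)] at h5
      simp only [Finsupp.cons_zero, Finsupp.cons_succ, zero_add] at h5
      have h6 : ∑ j, (γ j.succ - d j) + ∑ j, d j = ∑ j : Fin N, γ j.succ := by
        rw [← Finset.sum_add_distrib]
        exact Finset.sum_congr rfl fun j _ => Nat.sub_add_cancel (hle d hd j)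
      have h7 : ∑ j : Fin N, (γ j.succ - b j.succ) + ∑ j : Fin N, b j.succ =
          ∑ j : Fin N, γ j.succ := by
        rw [← Finset.sum_add_distrib]
        exact Finset.sum_congr rfl fun j _ => Nat.sub_add_cancel (hγ b hb j.succ)
      rw [Fin.sum_univ_succ, Fin.sum_univ_succ]
      simp only [Fin.zero_le, if_true, lt_irrefl, if_false, Fin.succ_pos]
      omega
    | succ c =>
      have h1 : translation K N (z'.coeff (b 0)) = Polynomial.C (z'.coeff (b 0)) := by
        ext1 i
        rw [← (Polynomial.hasTopCoeff_extendTranslation hdeg i).2, hinv, Polynomial.coeff_C,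
          Polynomial.coeff_C]
        split_ifs <;> simp
      have := ih (z'.coeff (b 0)) (fun j => γ j.succ) b.tail
        (fun d hd j => by simpa using hγ _ (hmem _ d hd) j.succ) h1 htail
        (by
          intro d hd
          have h5 := hhom _ (hmem _ d hd)
          rw [Fin.sum_univ_succ, Fin.sum_univ_succ (fun j => b j)] at h5
          simpa [Finsupp.tail_apply] using h5)
        (by
          intro d hd c hc
          have := hlex _ (hmem _ d hd) c.succ (fun j hj => by
            induction j using Fin.cases with
            | zero => simp
            | succ j => simpa [Finsupp.tail_apply] using hc j (Fin.succ_lt_succ_iff.mp hj))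
          simpa [Finsupp.tail_apply] using this)
        c
      rw [Fin.sum_univ_succ, Fin.sum_univ_succ]
      simpa [Fin.succ_le_succ_iff, Fin.succ_lt_succ_iff, Finsupp.tail_apply] using this

end MvPolynomial

/-! ### Row operations as translations. -/

namespace MvPolynomial

section RowShift

variable (K : Type*) [CommRing K] {σ : Type*} {N : ℕ} (x y : Fin N → σ)

/-- The substitution that adds `t` times the row of variables `x` to the row of variables `y`. -/
noncomputable def rowShift : MvPolynomial σ K →+* Polynomial (MvPolynomial σ K) :=
  eval₂Hom (Polynomial.C.comp C) fun v => Polynomial.C (X v) +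
    Function.extend y (fun c => Polynomial.C (X (x c)) * Polynomial.X) 0 v

/-- The substitution `y c ↦ x c * Y c`, where the `Y c` are new variables, placed in the
coefficient ring. -/
noncomputable def splitRow : MvPolynomial σ K →+* MvPolynomial σ (MvPolynomial (Fin N) K) :=
  eval₂Hom (C.comp C) fun v => X (Function.extend y x id v) * C (Function.extend y X 1 v)

variable {K x y} (hy : Function.Injective y) (hxy : ∀ c d, x c ≠ y d)

include hy hxy in
-- This is the identity `x c * Y c + t * x c = x c * (Y c + t)`; the variables outside the row `y`
-- do not move.
theorem splitRow_rowShift (f : MvPolynomial σ K) :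
    (rowShift K x y f).eval₂ ((map Polynomial.C).comp (splitRow K x y)) (C Polynomial.X) =
      map (translation K N) (splitRow K x y f) := by
  have : (Polynomial.eval₂RingHom ((map Polynomial.C).comp (splitRow K x y))
      (C Polynomial.X)).comp (rowShift K x y) =
      (map (translation K N)).comp (splitRow K x y) := by
    apply ringHom_ext
    · intro r
      simp [rowShift, splitRow, translation]
    · intro v
      by_cases hv : ∃ c, y c = v
      · obtain ⟨c, rfl⟩ := hv
        have hx : ¬ ∃ d, y d = x c := fun ⟨d, hd⟩ => hxy c d hd.symm
        simp [rowShift, splitRow, translation, hy.extend_apply, Function.extend_apply' _ _ _ hx,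
          mul_add]
      · simp [rowShift, splitRow, translation, Function.extend_apply' _ _ _ hv]
  exact congrArg (fun g => g f) this

include hy hxy in
theorem translation_coeff_splitRow {f : MvPolynomial σ K}
    (hf : rowShift K x y f = Polynomial.C f) (n : σ →₀ ℕ) :
    translation K N (coeff n (splitRow K x y f)) = Polynomial.C (coeff n (splitRow K x y f)) := by
  have h := splitRow_rowShift hy hxy f
  rw [hf, Polynomial.eval₂_C] at h
  have := congrArg (coeff n) h
  rw [coeff_map] at this
  rw [← this, RingHom.comp_apply, coeff_map]

include hy in
theorem splitRow_monomial (m : σ →₀ ℕ) (r : K) :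
    splitRow K x y (monomial m r) = monomial (m.mapDomain (Function.extend y x id))
      (monomial (m.comapDomain y hy.injOn) r) := by
  induction m using Finsupp.induction_linear generalizing r with
  | zero => simp [splitRow]
  | add m m' ih ih' =>
    have h := ih r
    have h' := ih' 1
    rw [← mul_one r, ← monomial_mul, map_mul, mul_one, h, h', Finsupp.mapDomain_add,
      Finsupp.comapDomain_add_of_injective hy, monomial_mul, monomial_mul, mul_one]
  | single v k =>
    rw [Finsupp.mapDomain_single, splitRow, coe_eval₂Hom, eval₂_monomial,
      Finsupp.prod_single_index (by simp), mul_pow, ← map_pow C, mul_left_comm, RingHom.comp_apply,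
      ← C_mul, X_pow_eq_monomial, mul_comm, C_mul_monomial, mul_one]
    congr 1
    by_cases hv : ∃ c, y c = v
    · obtain ⟨c, rfl⟩ := hv
      rw [hy.extend_apply, Finsupp.comapDomain_single, X_pow_eq_monomial, C_mul_monomial, mul_one]
    · rw [Function.extend_apply' _ _ _ hv]
      have : (Finsupp.single v k).comapDomain y hy.injOn = 0 := by
        classical
        ext c
        rw [Finsupp.comapDomain_apply, Finsupp.single_apply, if_neg fun h => hv ⟨c, h.symm⟩]
        rfl
      simp [this]

include hy hxy in
theorem mapDomain_extend_apply (hx : Function.Injective x) (m : σ →₀ ℕ) (c : Fin N) :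
    m.mapDomain (Function.extend y x id) (x c) = m (x c) + m (y c) := by
  classical
  induction m using Finsupp.induction_linear with
  | zero => simp
  | add m m' ih ih' => rw [Finsupp.mapDomain_add]; simp only [Finsupp.add_apply, ih, ih']; ring
  | single v k =>
    rw [Finsupp.mapDomain_single]
    by_cases hv : ∃ d, y d = v
    · obtain ⟨d, rfl⟩ := hv
      rw [hy.extend_apply]
      simp [Finsupp.single_apply, hx.eq_iff, hy.eq_iff, (hxy c d).symm]
    · rw [Function.extend_apply' _ _ _ hv]
      have : v ≠ y c := fun h => hv ⟨c, h.symm⟩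
      simp [Finsupp.single_apply, this]

include hy in
theorem mapDomain_extend_apply_of_notMem (m : σ →₀ ℕ) {v : σ} (hvx : v ∉ Set.range x)
    (hvy : v ∉ Set.range y) : m.mapDomain (Function.extend y x id) v = m v := by
  classical
  induction m using Finsupp.induction_linear with
  | zero => simp
  | add m m' ih ih' => rw [Finsupp.mapDomain_add]; simp only [Finsupp.add_apply, ih, ih']
  | single u k =>
    rw [Finsupp.mapDomain_single]
    by_cases hu : ∃ d, y d = u
    · obtain ⟨d, rfl⟩ := hu
      rw [hy.extend_apply, Finsupp.single_apply, Finsupp.single_apply,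
        if_neg fun h => hvx ⟨d, h⟩, if_neg fun h => hvy ⟨d, h⟩]
    · rw [Function.extend_apply' _ _ _ hu]
      rfl

include hy in
theorem coeff_coeff_splitRow [DecidableEq σ] (f : MvPolynomial σ K) (n : σ →₀ ℕ) (b : Fin N →₀ ℕ) :
    coeff b (coeff n (splitRow K x y f)) = ∑ m ∈ f.support,
      if m.mapDomain (Function.extend y x id) = n ∧ m.comapDomain y hy.injOn = b
      then coeff m f else 0 := by
  conv_lhs => rw [f.as_sum, map_sum, coeff_sum, coeff_sum]
  refine Finset.sum_congr rfl fun m _ => ?_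
  rw [splitRow_monomial hy, coeff_monomial]
  by_cases h : m.mapDomain (Function.extend y x id) = n
  · simp [h, coeff_monomial]
  · simp [h]

include hy in
theorem exists_of_mem_support_coeff_splitRow {f : MvPolynomial σ K} {n : σ →₀ ℕ}
    {b : Fin N →₀ ℕ} (hb : b ∈ (coeff n (splitRow K x y f)).support) :
    ∃ m ∈ f.support, m.mapDomain (Function.extend y x id) = n ∧ ∀ c, m (y c) = b c := by
  classical
  rw [mem_support_iff, coeff_coeff_splitRow hy] at hb
  obtain ⟨m, hm, hne⟩ := Finset.exists_ne_zero_of_sum_ne_zero hb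
  obtain ⟨h1, h2⟩ := (ite_ne_right_iff.mp hne).1
  exact ⟨m, hm, h1, fun c => by rw [← h2]; rfl⟩

include hy hxy in
-- No cancellation can occur: the merged exponents together with the exponents of the row `y`
-- determine the monomial.
theorem comapDomain_mem_support (hx : Function.Injective x) {f : MvPolynomial σ K} {m : σ →₀ ℕ}
    (hm : m ∈ f.support) : m.comapDomain y hy.injOn ∈
      (coeff (m.mapDomain (Function.extend y x id)) (splitRow K x y f)).support := by
  classical
  rw [mem_support_iff, coeff_coeff_splitRow hy, Finset.sum_eq_single_of_mem m hm]
  · simpa using mem_support_iff.mp hm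
  · intro m' _ hne
    refine if_neg fun ⟨h1, h2⟩ => hne ?_
    have hy' : ∀ c, m' (y c) = m (y c) := fun c => DFunLike.congr_fun h2 c
    ext v
    by_cases hvy : v ∈ Set.range y
    · obtain ⟨c, rfl⟩ := hvy
      exact hy' c
    by_cases hvx : v ∈ Set.range x
    · obtain ⟨c, rfl⟩ := hvx
      have := DFunLike.congr_fun h1 (x c)
      rw [mapDomain_extend_apply hy hxy hx, mapDomain_extend_apply hy hxy hx, hy'] at this
      exact Nat.add_right_cancel this
    · have := DFunLike.congr_fun h1 v
      rwa [mapDomain_extend_apply_of_notMem hy m' hvx hvy,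
        mapDomain_extend_apply_of_notMem hy m hvx hvy] at this

variable [IsDomain K]

include hy hxy in
/-- If `f` is invariant under adding multiples of the row `x` to the row `y`, and `m` is a monomial
of `f` for which the exponents of the row `y` are lexicographically minimal, then these exponents
satisfy the ballot condition. -/
theorem ballot_of_rowShift_eq_of_min (hx : Function.Injective x) {f : MvPolynomial σ K}
    (hf : rowShift K x y f = Polynomial.C f) {m : σ →₀ ℕ} (hm : m ∈ f.support)
    (hlex : ∀ m' ∈ f.support, (∀ v ∉ Set.range x, v ∉ Set.range y → m' v = m v) →
      (∀ c, m' (x c) + m' (y c) = m (x c) + m (y c)) →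
      ∀ c, (∀ j < c, m' (y j) = m (y j)) → m (y c) ≤ m' (y c)) (c : Fin N) :
    (∑ j, if j ≤ c then m (y j) else 0) ≤ ∑ j, if j < c then m (x j) else 0 := by
  have key : ∀ b' ∈ (coeff (m.mapDomain (Function.extend y x id)) (splitRow K x y f)).support,
      ∃ m' ∈ f.support, (∀ v ∉ Set.range x, v ∉ Set.range y → m' v = m v) ∧
        (∀ c, m' (x c) + m' (y c) = m (x c) + m (y c)) ∧ ∀ c, m' (y c) = b' c := by
    intro b' hb'
    obtain ⟨m', hm', h1, h2⟩ := exists_of_mem_support_coeff_splitRow hy hb'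
    refine ⟨m', hm', fun v hvx hvy => ?_, fun c => ?_, h2⟩
    · rw [← mapDomain_extend_apply_of_notMem hy m' hvx hvy, h1,
        mapDomain_extend_apply_of_notMem hy m hvx hvy]
    · rw [← mapDomain_extend_apply hy hxy hx, h1, mapDomain_extend_apply hy hxy hx]
  -- The merged exponent bounds the degree in `Y c`, and its excess over the exponent of `y c` is
  -- the exponent of `x c`. Invariance allows `w = 0`.
  have := (ballot_of_natDegree_translation_le _ (fun c => m (x c) + m (y c)) _ 0
    (fun b' hb' j => ?_) ?_ (comapDomain_mem_support hy hxy hx hm) ?_).1 c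
  · simpa using this
  · obtain ⟨m', -, -, h2, h3⟩ := key b' hb'
    rw [← h2, ← h3]
    exact Nat.le_add_left _ _
  · rw [translation_coeff_splitRow hy hxy hf, Polynomial.natDegree_C]
  · intro b' hb' c hc
    obtain ⟨m', hm', h1, h2, h3⟩ := key b' hb'
    rw [← h3]
    exact hlex m' hm' h1 h2 c fun j hj => by rw [h3, hc j hj]; rfl

include hy hxy in
/-- If `f` is invariant under adding multiples of the row `x` to the row `y`, and `m` is a monomial
of `f` for which the exponents of the row `y` are lexicographically maximal, then these exponents
satisfy the reversed ballot condition. -/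
theorem ballot_of_rowShift_eq_of_max (hx : Function.Injective x) {f : MvPolynomial σ K}
    (hf : rowShift K x y f = Polynomial.C f) {m : σ →₀ ℕ} (hm : m ∈ f.support)
    (hhom : ∀ m' ∈ f.support, (∀ v ∉ Set.range x, v ∉ Set.range y → m' v = m v) →
      ∑ c, m' (y c) = ∑ c, m (y c))
    (hlex : ∀ m' ∈ f.support, (∀ v ∉ Set.range x, v ∉ Set.range y → m' v = m v) →
      (∀ c, m' (x c) + m' (y c) = m (x c) + m (y c)) →
      ∀ c, (∀ j < c, m' (y j) = m (y j)) → m' (y c) ≤ m (y c)) (c : Fin N) :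
    (∑ j, if c ≤ j then m (y j) else 0) ≤ ∑ j, if c < j then m (x j) else 0 := by
  have key : ∀ b' ∈ (coeff (m.mapDomain (Function.extend y x id)) (splitRow K x y f)).support,
      ∃ m' ∈ f.support, (∀ v ∉ Set.range x, v ∉ Set.range y → m' v = m v) ∧
        (∀ c, m' (x c) + m' (y c) = m (x c) + m (y c)) ∧ ∀ c, m' (y c) = b' c := by
    intro b' hb'
    obtain ⟨m', hm', h1, h2⟩ := exists_of_mem_support_coeff_splitRow hy hb'
    refine ⟨m', hm', fun v hvx hvy => ?_, fun c => ?_, h2⟩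
    · rw [← mapDomain_extend_apply_of_notMem hy m' hvx hvy, h1,
        mapDomain_extend_apply_of_notMem hy m hvx hvy]
    · rw [← mapDomain_extend_apply hy hxy hx, h1, mapDomain_extend_apply hy hxy hx]
  have := ballot_of_translation_eq _ (fun c => m (x c) + m (y c)) _
    (fun b' hb' j => ?_) (translation_coeff_splitRow hy hxy hf _)
    (comapDomain_mem_support hy hxy hx hm) (fun b' hb' => ?_) ?_ c
  · simpa using this
  · obtain ⟨m', -, -, h2, h3⟩ := key b' hb'
    rw [← h2, ← h3]
    exact Nat.le_add_left _ _
  · obtain ⟨m', hm', h1, -, h3⟩ := key b' hb'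
    simp only [← h3]
    exact hhom m' hm' h1
  · intro b' hb' c hc
    obtain ⟨m', hm', h1, h2, h3⟩ := key b' hb'
    rw [← h3]
    exact hlex m' hm' h1 h2 c fun j hj => by rw [h3, hc j hj]; rfl

end RowShift

end MvPolynomial

/-! ### Paths and branches in a Y-shaped quiver. -/

namespace FlagQuiver

variable {ρ : ℕ} {Q : FlagQuiver ρ}

variable (Q) in
/-- There is a path from `v` to `i`. -/
abbrev Reach (v i : Fin (ρ + 1)) : Prop := Relation.ReflTransGen (fun u v => 0 < Q.n u v) v i

theorem lt_of_arrow {u v : Fin (ρ + 1)} (h : 0 < Q.n u v) : u < v :=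
  not_le.mp fun hle => h.ne' (Q.n_eq_zero u v hle)

theorem Reach.le {v i : Fin (ρ + 1)} (h : Q.Reach v i) : v ≤ i := by
  induction h with
  | refl => exact le_rfl
  | tail _ h ih => exact ih.trans (lt_of_arrow h).le

theorem Reach.ne_zero {v i : Fin (ρ + 1)} (h : Q.Reach v i) (hv : v ≠ 0) : i ≠ 0 := by
  rintro rfl
  exact hv (le_antisymm h.le (Fin.zero_le _))

theorem IsYShaped.val_one (h : IsYShaped Q) : ((1 : Fin (ρ + 1)) : ℕ) = 1 := by
  have := h.pos
  rw [Fin.val_one', Nat.mod_eq_of_lt (by omega)]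

theorem IsYShaped.one_ne_zero (h : IsYShaped Q) : (1 : Fin (ρ + 1)) ≠ 0 := fun h' => by
  have := congrArg Fin.val h'
  rw [h.val_one] at this
  simp at this

theorem IsYShaped.eq_one_or_one_lt (h : IsYShaped Q) {v : Fin (ρ + 1)} (hv : v ≠ 0) :
    v = 1 ∨ 1 < v := by
  have h1 := h.val_one
  have h2 : (v : ℕ) ≠ 0 := fun h' => hv (Fin.ext h')
  rw [Fin.ext_iff, Fin.lt_def]
  omega

theorem IsYShaped.reach_one (h : IsYShaped Q) {v : Fin (ρ + 1)} (hv : v ≠ 0) : Q.Reach 1 v := by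
  rcases h.eq_one_or_one_lt hv with rfl | hv
  · exact .refl
  · exact (h.reach v hv).to_reflTransGen

theorem IsYShaped.unique_pred (h : IsYShaped Q) {i i' j : Fin (ρ + 1)} (hi : i ≠ 0) (hi' : i' ≠ 0)
    (hij : 0 < Q.n i j) (hij' : 0 < Q.n i' j) : i = i' :=
  (h.unique_in hi hi' ⟨0, hij⟩ ⟨0, hij'⟩).1

/-- Going backwards from `t` there is at most one arrow with non-source origin at each step, so the
vertices `≠ 0` that reach `t` form a chain. -/
theorem IsYShaped.reach_total (h : IsYShaped Q) {v v' t : Fin (ρ + 1)} (hv : v ≠ 0) (hv' : v' ≠ 0)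
    (hvt : Q.Reach v t) (hvt' : Q.Reach v' t) : Q.Reach v v' ∨ Q.Reach v' v := by
  induction hvt with
  | refl => exact .inr hvt'
  | @tail b c hb hbc ih =>
    rcases Relation.ReflTransGen.cases_tail hvt' with rfl | ⟨b', hb', hbc'⟩
    · exact .inl (hb.tail hbc)
    · obtain rfl := h.unique_pred (Reach.ne_zero hb hv) (Reach.ne_zero hb' hv') hbc hbc'
      exact ih hb'

theorem IsYShaped.unique_succ (h : IsYShaped Q) {i j j' : Fin (ρ + 1)} (hi : 1 < i)
    (hij : 0 < Q.n i j) (hij' : 0 < Q.n i j') : j = j' := by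
  by_contra hne
  have h1 := Finset.sum_le_sum_of_subset (f := fun u => Q.n i u)
    (Finset.subset_univ ({j, j'} : Finset (Fin (ρ + 1))))
  rw [Finset.sum_pair hne] at h1
  have := h.out_le i hi
  omega

theorem IsYShaped.reach_total' (h : IsYShaped Q) {t v v' : Fin (ρ + 1)} (ht : 1 < t)
    (hv : Q.Reach t v) (hv' : Q.Reach t v') : Q.Reach v v' ∨ Q.Reach v' v := by
  induction hv using Relation.ReflTransGen.head_induction_on with
  | refl => exact .inl hv'
  | @head a c hac hc ih =>
    rcases Relation.ReflTransGen.cases_head hv' with rfl | ⟨c', hac', hc'⟩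
    · exact .inr (hc.head hac)
    · obtain rfl := h.unique_succ ht hac hac'
      exact ih (ht.trans (lt_of_arrow hac)) hc'

section Branch

variable {e : Q.BranchNumbering} {b b' : Fin 2} {v i : Fin (ρ + 1)}

theorem one_lt_of_mem_branch (hv : v ∈ branch e b) : 1 < v := by
  obtain ⟨j, a, -, hj⟩ := hv
  exact (lt_of_arrow a.pos).trans_le (Reach.le hj)

theorem ne_zero_of_mem_branch (hv : v ∈ branch e b) : v ≠ 0 := by
  rintro rfl
  exact absurd (one_lt_of_mem_branch hv) (not_lt.mpr (Fin.zero_le _))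

theorem mem_branch_of_reach (hv : v ∈ branch e b) (hvi : Q.Reach v i) : i ∈ branch e b := by
  obtain ⟨j, a, ha, hj⟩ := hv
  exact ⟨j, a, ha, hj.trans hvi⟩

variable (hQ : IsYShaped Q)
include hQ

variable (e) in
theorem exists_mem_branch (hv : 1 < v) : ∃ b, v ∈ branch e b := by
  obtain ⟨j, hj, hjv⟩ := Relation.TransGen.head'_iff.mp (hQ.reach v hv)
  exact ⟨e ⟨j, ⟨0, hj⟩⟩, j, ⟨0, hj⟩, rfl, hjv⟩

theorem branch_unique (hv : v ∈ branch e b) (hv' : v ∈ branch e b') : b = b' := by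
  obtain ⟨j, a, rfl, hj⟩ := hv
  obtain ⟨j', a', rfl, hj'⟩ := hv'
  -- A nontrivial path from `j` to `j'` would enter `j'` from a non-source vertex beyond `1`,
  -- although `1` is already its only such predecessor.
  have key : ∀ {j j' : Fin (ρ + 1)}, 0 < Q.n 1 j → 0 < Q.n 1 j' → Q.Reach j j' → j = j' := by
    intro j j' h h' hr
    rcases Relation.ReflTransGen.cases_tail hr with h1 | ⟨c, hc, hc'⟩
    · exact h1.symm
    · have hj : j ≠ 0 := fun h0 => by
        have := lt_of_arrow h
        rw [h0] at this
        exact absurd this (not_lt.mpr (Fin.zero_le _))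
      obtain rfl := hQ.unique_pred (Reach.ne_zero hc hj) hQ.one_ne_zero hc' h'
      exact absurd (lt_of_arrow h) (not_lt.mpr (Reach.le hc))
  have hj0 : ∀ {j : Fin (ρ + 1)}, 0 < Q.n 1 j → j ≠ 0 := by
    rintro j h rfl
    exact absurd (lt_of_arrow h) (not_lt.mpr (Fin.zero_le _))
  obtain rfl : j = j' := by
    rcases hQ.reach_total (hj0 a.pos) (hj0 a'.pos) hj hj' with h | h
    · exact key a.pos a'.pos h
    · exact (key a'.pos a.pos h).symm
  rw [eq_of_heq (hQ.unique_in hQ.one_ne_zero hQ.one_ne_zero a a').2]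

theorem reach_total_of_mem_branch (hv : v ∈ branch e b) (hi : i ∈ branch e b) :
    Q.Reach v i ∨ Q.Reach i v := by
  obtain ⟨j, a, ha, hj⟩ := hv
  obtain ⟨j', a', ha', hj'⟩ := hi
  obtain rfl : j = j' := congrArg Sigma.fst (e.injective (ha.trans ha'.symm))
  exact hQ.reach_total' (lt_of_arrow a.pos) hj hj'

theorem eq_one_or_mem_branch_of_reach (hv : v ≠ 0) (hvi : Q.Reach v i) (hi : i ∈ branch e b) :
    v = 1 ∨ v ∈ branch e b := by
  refine (hQ.eq_one_or_one_lt hv).imp_right fun h => ?_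
  obtain ⟨b', hb'⟩ := exists_mem_branch e hQ h
  rwa [branch_unique hQ hi (mem_branch_of_reach hb' hvi)]

theorem eq_one_or_mem_branch_one (hv : v ≠ 0) (hv0 : v ∉ branch e 0) : v = 1 ∨ v ∈ branch e 1 := by
  refine (hQ.eq_one_or_one_lt hv).imp_right fun h => ?_
  obtain ⟨b, hb⟩ := exists_mem_branch e hQ h
  match b with
  | 0 => exact absurd hb hv0
  | 1 => exact hb

omit hQ in
theorem pos_of_mem (hv : v ∈ branch e 0) : pos e v = -(v : ℤ) := if_pos hv

omit hQ in
theorem pos_of_notMem (hv : v ∉ branch e 0) : pos e v = (v : ℤ) := if_neg hv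

/-- The vertices listed after a vertex `v` of the first branch precede `v` in the quiver, except for
those in the second branch. -/
theorem reach_of_pos_le_of_mem (hv : v ∈ branch e 0) (hi0 : i ≠ 0) (hi : i ∉ branch e 1)
    (h : pos e v ≤ pos e i) : Q.Reach i v := by
  rcases hQ.eq_one_or_one_lt hi0 with rfl | hi1
  · exact hQ.reach_one (ne_zero_of_mem_branch hv)
  obtain ⟨b, hb⟩ := exists_mem_branch e hQ hi1
  have hb0 : i ∈ branch e 0 := match b, hb with
    | 0, hb => hb
    | 1, hb => absurd hb hi
  rw [pos_of_mem hv, pos_of_mem hb0] at h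
  rcases reach_total_of_mem_branch hQ hv hb0 with h1 | h1
  · obtain rfl : v = i := le_antisymm (Reach.le h1) (by rw [Fin.le_def]; omega)
    exact .refl
  · exact h1

/-- First-branch vertices have negative position, so they cannot follow `v`. The remaining vertices
other than `0` form the chain consisting of `1` and the second branch, listed by number. -/
theorem reach_of_pos_le_of_notMem (hv : v ∉ branch e 0) (hv0 : v ≠ 0)
    (h : pos e v ≤ pos e i) : i ∉ branch e 0 ∧ Q.Reach v i := by
  have hi : i ∉ branch e 0 := by
    intro hi
    rw [pos_of_mem hi, pos_of_notMem hv] at h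
    exact hv0 (Fin.ext (show (v : ℕ) = 0 by omega))
  have hi0 : i ≠ 0 := by
    rintro rfl
    rw [pos_of_notMem hi, pos_of_notMem hv] at h
    have h0 : ((0 : Fin (ρ + 1)) : ℕ) = 0 := rfl
    exact hv0 (Fin.ext (show (v : ℕ) = 0 by omega))
  refine ⟨hi, ?_⟩
  rw [pos_of_notMem hi, pos_of_notMem hv] at h
  have hvi : v ≤ i := by rw [Fin.le_def]; omega
  rcases eq_one_or_mem_branch_one hQ hv0 hv with rfl | hv1
  · exact hQ.reach_one hi0
  rcases eq_one_or_mem_branch_one hQ hi0 hi with rfl | hi1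
  · exact absurd (one_lt_of_mem_branch hv1) (not_lt.mpr hvi)
  rcases reach_total_of_mem_branch hQ hv1 hi1 with h1 | h1
  · exact h1
  · obtain rfl : v = i := le_antisymm hvi (Reach.le h1)
    exact .refl

end Branch

/-! ### Rows, columns and sizes of the matrices. -/

theorem ne_zero_of_row {i : Fin (ρ + 1)} (j : Fin (Q.s i - Q.r i)) : i ≠ 0 := by
  rintro rfl
  have h : Q.s 0 = 0 := Finset.sum_eq_zero fun j _ => by
    rw [Q.n_eq_zero j 0 (Fin.zero_le _), zero_mul]
  have := j.pos
  omega

/-- The vertex at which a row is introduced, and its number there. -/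
def Row.origin : {i : Fin (ρ + 1)} → Q.Row i → Σ v, Fin (Q.s v - Q.r v)
  | i, .new j => ⟨i, j⟩
  | _, .ext _ w => w.origin

/-- The columns in which a row can be different from zero. -/
def Row.emb : {i : Fin (ρ + 1)} → (w : Q.Row i) → Q.Col w.origin.1 → Q.Col i
  | _, .new _ => fun c => c
  | _, .ext a w => fun c => .ext a (w.emb c)

theorem Row.start_emb {i : Fin (ρ + 1)} (w : Q.Row i) (c : Q.Col w.origin.1) :
    (w.emb c).start = c.start := by
  induction w with
  | new j => rfl
  | ext a w ih => exact ih c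

theorem Row.key_emb (e : Q.BranchNumbering) {i : Fin (ρ + 1)} (w : Q.Row i)
    (c : Q.Col w.origin.1) : (w.emb c).key e = c.key e := by
  rw [Col.key, Col.key, w.start_emb]

theorem entry_emb {i : Fin (ρ + 1)} (w : Q.Row i) (c : Q.Col w.origin.1) :
    Q.entry w (w.emb c) = MvPolynomial.X ⟨w.origin.1, w.origin.2, c⟩ := by
  induction w with
  | new j => simp [Row.emb, entry]; rfl
  | ext a w ih =>
    rw [Row.emb, entry, dif_pos rfl, if_pos rfl]
    exact ih c

theorem exists_emb_of_entry_ne_zero {i : Fin (ρ + 1)} (w : Q.Row i) (c : Q.Col i)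
    (h : Q.entry w c ≠ 0) : ∃ c', w.emb c' = c := by
  induction w with
  | new j => exact ⟨c, rfl⟩
  | @ext i j a w ih =>
    cases c with
    | root b => simp [entry] at h
    | @ext i' _ a' c =>
      rw [entry] at h
      split_ifs at h with h1 h2
      · subst h1
        obtain ⟨c', rfl⟩ := ih c h
        exact ⟨c', by rw [← h2]; rfl⟩
      · exact absurd rfl h
      · exact absurd rfl h

theorem Row.reach_origin {i : Fin (ρ + 1)} (w : Q.Row i) : Q.Reach w.origin.1 i := by
  induction w with
  | new j => exact .refl
  | ext a w ih => exact ih.tail a.pos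

theorem Row.ne_zero {i : Fin (ρ + 1)} (w : Q.Row i) : i ≠ 0 :=
  Reach.ne_zero w.reach_origin (ne_zero_of_row w.origin.2)

/-- An inherited row is determined by where it was introduced because, with unique non-source
predecessors, two vertices other than `0` are joined by at most one path. -/
theorem Row.origin_injective (h : IsYShaped Q) {i : Fin (ρ + 1)} :
    Function.Injective (Row.origin : Q.Row i → _) := by
  have key : ∀ {i j : Fin (ρ + 1)} (a : Fin (Q.n i j)) (w : Q.Row i)
      (b : Fin (Q.s j - Q.r j)), (Row.ext a w).origin ≠ (Row.new b).origin := by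
    intro i j a w b heq
    have h1 : w.origin.1 = j := congrArg Sigma.fst heq
    exact absurd (h1 ▸ Reach.le w.reach_origin) (not_le.mpr (lt_of_arrow a.pos))
  intro w w' hw
  induction w with
  | new j =>
    cases w' with
    | new j' => rw [eq_of_heq (Sigma.mk.inj hw).2]
    | ext a' w' => exact absurd hw.symm (key a' w' j)
  | ext a w ih =>
    cases w' with
    | new j' => exact absurd hw (key a w j')
    | ext a' w' =>
      obtain ⟨rfl, ha⟩ := h.unique_in w.ne_zero w'.ne_zero a a'
      obtain rfl := eq_of_heq ha
      rw [ih hw]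

theorem exists_row_origin_eq {v i : Fin (ρ + 1)} (h : Q.Reach v i) (j : Fin (Q.s v - Q.r v)) :
    ∃ w : Q.Row i, w.origin = ⟨v, j⟩ := by
  induction h with
  | refl => exact ⟨.new j, rfl⟩
  | tail _ h ih =>
    obtain ⟨w, hw⟩ := ih
    exact ⟨.ext ⟨0, h⟩ w, hw⟩

theorem exists_col_start_eq {v i : Fin (ρ + 1)} (h : Q.Reach v i) (c : Q.Col v) :
    ∃ c' : Q.Col i, c'.start = c.start := by
  induction h with
  | refl => exact ⟨c, rfl⟩
  | tail _ h ih =>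
    obtain ⟨c', hc'⟩ := ih
    exact ⟨.ext ⟨0, h⟩ c', hc'⟩

theorem Col.reach_start {i : Fin (ρ + 1)} (c : Q.Col i) : Q.Reach c.start.1 i := by
  induction c with
  | root a => exact .refl
  | ext a c ih => exact ih.tail a.pos

theorem Col.exists_root {i : Fin (ρ + 1)} (c : Q.Col i) :
    ∃ c' : Q.Col c.start.1, c'.start = c.start := by
  induction c with
  | root a => exact ⟨.root a, rfl⟩
  | ext a c ih => exact ih

theorem Col.start_ne_zero {i : Fin (ρ + 1)} (c : Q.Col i) : c.start.1 ≠ 0 :=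
  c.exists_root.choose.ne_zero

theorem Col.exists_start_eq {i v : Fin (ρ + 1)} (c : Q.Col i) (h : Q.Reach c.start.1 v) :
    ∃ c' : Q.Col v, c'.start = c.start := by
  obtain ⟨c₁, hc₁⟩ := c.exists_root
  obtain ⟨c₂, hc₂⟩ := exists_col_start_eq h c₁
  exact ⟨c₂, hc₂.trans hc₁⟩

/-- Going from the matrix `A i` to the matrix `A j`, the additional columns are added on the left
if `j` is in the first branch. -/
theorem Col.key_lt_of_mem_branch (hQ : IsYShaped Q) {e : Q.BranchNumbering} {i j : Fin (ρ + 1)}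
    (hj : j ∈ branch e 0) (hij : Q.Reach i j) (d : Q.Col i) (c : Q.Col j)
    (hc : ∀ c' : Q.Col i, c'.start ≠ c.start) : c.key e < d.key e := by
  -- The starting vertex of `c` is comparable with `i`; if it reached `i`, then `c` would be
  -- inherited from `A i`.
  have h1 : Q.Reach i c.start.1 := by
    rcases hQ.reach_total d.ne_zero c.start_ne_zero hij c.reach_start with h | h
    · exact h
    · obtain ⟨c', hc'⟩ := c.exists_start_eq h
      exact absurd hc' (hc c')
  have hne : c.start.1 ≠ i := fun h => by
    obtain ⟨c', hc'⟩ := c.exists_start_eq (v := i) (h ▸ .refl)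
    exact hc c' hc'
  have hlt : d.start.1 < c.start.1 := (Reach.le d.reach_start).trans_lt
    (lt_of_le_of_ne (Reach.le h1) hne.symm)
  have hc0 : c.start.1 ∈ branch e 0 := by
    rcases eq_one_or_mem_branch_of_reach hQ c.start_ne_zero c.reach_start hj with h | h
    · rw [h] at hlt
      rcases hQ.eq_one_or_one_lt d.start_ne_zero with h' | h'
      · rw [h'] at hlt; exact absurd hlt (lt_irrefl _)
      · exact absurd hlt h'.asymm
    · exact h
  refine Prod.Lex.toLex_lt_toLex.mpr (.inl ?_)
  simp only [pos_of_mem hc0]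
  unfold pos
  rw [Fin.lt_def] at hlt
  split_ifs <;> omega

/-- Going from the matrix `A i` to the matrix `A j`, the additional columns are added on the right
if `j` is not in the first branch. -/
theorem Col.lt_key_of_notMem_branch (hQ : IsYShaped Q) {e : Q.BranchNumbering} {i j : Fin (ρ + 1)}
    (hj : j ∉ branch e 0) (hij : Q.Reach i j) (d : Q.Col i) (c : Q.Col j)
    (hc : ∀ c' : Q.Col i, c'.start ≠ c.start) : d.key e < c.key e := by
  have h1 : Q.Reach i c.start.1 := by
    rcases hQ.reach_total d.ne_zero c.start_ne_zero hij c.reach_start with h | h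
    · exact h
    · obtain ⟨c', hc'⟩ := c.exists_start_eq h
      exact absurd hc' (hc c')
  have hne : c.start.1 ≠ i := fun h => by
    obtain ⟨c', hc'⟩ := c.exists_start_eq (v := i) (h ▸ .refl)
    exact hc c' hc'
  have hlt : d.start.1 < c.start.1 := (Reach.le d.reach_start).trans_lt
    (lt_of_le_of_ne (Reach.le h1) hne.symm)
  have hc0 : c.start.1 ∉ branch e 0 := fun h => hj (mem_branch_of_reach h c.reach_start)
  have hd0 : d.start.1 ∉ branch e 0 := fun h =>
    hj (mem_branch_of_reach h (d.reach_start.trans hij))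
  refine Prod.Lex.toLex_lt_toLex.mpr (.inl ?_)
  simp only [pos_of_notMem hc0, pos_of_notMem hd0]
  rw [Fin.lt_def] at hlt
  omega

section Card

variable (Q) in
/-- The columns of `A j` are the new ones and the inherited ones. -/
def colEquiv (j : Fin (ρ + 1)) :
    Q.Col j ≃ Fin (Q.n 0 j) ⊕ Σ i, Fin (Q.n i j) × Q.Col i where
  toFun
    | .root a => .inl a
    | .ext a c => .inr ⟨_, a, c⟩
  invFun
    | .inl a => .root a
    | .inr ⟨_, a, c⟩ => .ext a c
  left_inv c := by cases c <;> rfl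
  right_inv c := by rcases c with a | ⟨i, a, c⟩ <;> rfl

variable (Q) in
/-- The rows of `A j` are the new ones and the inherited ones. -/
def rowEquiv (j : Fin (ρ + 1)) :
    Q.Row j ≃ Fin (Q.s j - Q.r j) ⊕ Σ i, Fin (Q.n i j) × Q.Row i where
  toFun
    | .new a => .inl a
    | .ext a c => .inr ⟨_, a, c⟩
  invFun
    | .inl a => .new a
    | .inr ⟨_, a, c⟩ => .ext a c
  left_inv c := by cases c <;> rfl
  right_inv c := by rcases c with a | ⟨i, a, c⟩ <;> rfl

theorem Row.finite (hQ : IsYShaped Q) (i : Fin (ρ + 1)) : Finite (Q.Row i) :=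
  Finite.of_injective _ (Row.origin_injective hQ)

theorem card_row_add (hQ : IsYShaped Q) (j : Fin (ρ + 1)) (hj : j ≠ 0) :
    Nat.card (Q.Row j) + Q.r j = Nat.card (Q.Col j) := by
  have := Row.finite hQ
  induction j using WellFoundedLT.induction with
  | ind j ih =>
    rw [Nat.card_congr (Q.rowEquiv j), Nat.card_congr (Q.colEquiv j), Nat.card_sum, Nat.card_sum,
      Nat.card_sigma, Nat.card_sigma, Nat.card_fin, Nat.card_fin]
    simp only [Nat.card_prod, Nat.card_fin]
    -- The extra summand accounts for the source: it has no rows or columns, but `r 0 = 1` makes its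
    -- term in `s j` count the arrows `0 → j`.
    have h1 : ∀ i, Q.n i j * Nat.card (Q.Col i) + (if i = 0 then Q.n 0 j else 0) =
        Q.n i j * Nat.card (Q.Row i) + Q.n i j * Q.r i := by
      intro i
      split_ifs with hi
      · subst hi
        have hc : IsEmpty (Q.Col 0) := ⟨fun c => c.ne_zero rfl⟩
        have hr : IsEmpty (Q.Row 0) := ⟨fun c => c.ne_zero rfl⟩
        simp [Q.r_zero]
      · rcases Nat.eq_zero_or_pos (Q.n i j) with h0 | h0
        · simp [h0]
        · rw [← mul_add, ih i (lt_of_arrow h0) hi, add_zero]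
    have h2 := Finset.sum_congr rfl fun (i : Fin (ρ + 1)) (_ : i ∈ Finset.univ) => h1 i
    rw [Finset.sum_add_distrib, Finset.sum_add_distrib, Finset.sum_ite_eq' Finset.univ,
      if_pos (Finset.mem_univ _)] at h2
    have h3 := Q.r_le j hj
    unfold s
    omega

theorem card_row (hQ : IsYShaped Q) (j : Fin (ρ + 1)) (hj : j ≠ 0) :
    Nat.card (Q.Row j) = Q.k j := by
  rw [k, sTilde, ← card_row_add hQ j hj, Nat.add_sub_cancel]

end Card

end FlagQuiver

/-! ### Initial terms of the minors. -/

namespace FlagQuiver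

variable {ρ : ℕ} {Q : FlagQuiver ρ}

theorem monomialOrder_lt_iff (hQ : IsYShaped Q) (e : Q.BranchNumbering) {m m' : Q.Var →₀ ℕ} :
    (monomialOrder hQ e).toSyn m < (monomialOrder hQ e).toSyn m' ↔
      ∃ v : Q.Var, (∀ u : Q.Var, u.key e < v.key e → m u = m' u) ∧ m v < m' v :=
  Iff.rfl

/-- The position of a row, from top to bottom. -/
noncomputable def Row.key (e : Q.BranchNumbering) {i : Fin (ρ + 1)} (w : Q.Row i) : ℤ ×ₗ ℕ :=
  toLex (pos e w.origin.1, (w.origin.2 : ℕ))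

theorem Row.key_injective (hQ : IsYShaped Q) (e : Q.BranchNumbering) {i : Fin (ρ + 1)} :
    Function.Injective (Row.key e : Q.Row i → _) := by
  intro w w' hw
  have h1 := toLex.injective hw
  refine Row.origin_injective hQ ?_
  have h2 := pos_injective e (congrArg Prod.fst h1)
  have h3 : (w.origin.2 : ℕ) = w'.origin.2 := congrArg Prod.snd h1
  generalize w.origin = o at h2 h3
  generalize w'.origin = o' at h2 h3
  obtain ⟨v, j⟩ := o
  obtain ⟨v', j'⟩ := o'
  obtain rfl : v = v' := h2
  obtain rfl : j = j' := Fin.ext h3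
  rfl

theorem Row.emb_injective (hQ : IsYShaped Q) {i : Fin (ρ + 1)} (w : Q.Row i) :
    Function.Injective w.emb := fun c c' h =>
  Col.start_injective hQ c c' (by rw [← w.start_emb, h, w.start_emb])

theorem Var.key_lt_key_iff (e : Q.BranchNumbering) (x y : Q.Var) :
    x.key e < y.key e ↔ (toLex (pos e x.vertex, (x.row : ℕ)) : ℤ ×ₗ ℕ) <
        toLex (pos e y.vertex, (y.row : ℕ)) ∨
      pos e x.vertex = pos e y.vertex ∧ (x.row : ℕ) = y.row ∧ x.col.key e < y.col.key e := by
  unfold Var.key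
  simp only [Prod.Lex.toLex_lt_toLex]
  tauto

/-- The variable in column `c` of the row `w`. -/
def Row.var {i : Fin (ρ + 1)} (w : Q.Row i) (c : Q.Col w.origin.1) : Q.Var :=
  ⟨w.origin.1, w.origin.2, c⟩

theorem Row.key_var_lt (e : Q.BranchNumbering) {i : Fin (ρ + 1)} {w w' : Q.Row i}
    (h : w.key e < w'.key e) (c : Q.Col w.origin.1) (c' : Q.Col w'.origin.1) :
    (w.var c).key e < (w'.var c').key e :=
  (Var.key_lt_key_iff e _ _).mpr (.inl h)

section LeadingTerm

open MvPolynomial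

variable (hQ : IsYShaped Q) (e : Q.BranchNumbering) {i : Fin (ρ + 1)}

include hQ in
-- At the topmost row moved by `σ`, the diagonal entry is replaced by one further right, hence by a
-- smaller variable; the rows above are unchanged and those below have only smaller variables.
theorem toSyn_sum_single_lt [Fintype (Q.Row i)] {σ : Equiv.Perm (Q.Row i)} (hσ : σ ≠ 1)
    {g : Q.Row i → Q.Col i} (hg : ∀ w w', w.key e < w'.key e → (g w).key e < (g w').key e)
    {f f' : (w : Q.Row i) → Q.Col w.origin.1} (hf : ∀ w, w.emb (f w) = g w)
    (hf' : ∀ w, w.emb (f' w) = g (σ w)) :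
    (monomialOrder hQ e).toSyn (∑ w : Q.Row i, Finsupp.single (w.var (f' w)) 1) <
      (monomialOrder hQ e).toSyn (∑ w : Q.Row i, Finsupp.single (w.var (f w)) 1) := by
  classical
  let _ : LinearOrder (Q.Row i) := LinearOrder.lift' (Row.key e) (Row.key_injective hQ e)
  have hlt : ∀ w w' : Q.Row i, w < w' ↔ w.key e < w'.key e := fun _ _ => Iff.rfl
  obtain ⟨w₀, hw₀, hmin⟩ := Finset.exists_min_image (Finset.univ.filter fun w => σ w ≠ w) id (by
    obtain ⟨w, hw⟩ := not_forall.mp (mt Equiv.ext hσ)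
    exact ⟨w, by simpa using hw⟩)
  have hfix : ∀ w < w₀, σ w = w := fun w hw => by
    by_contra hne
    exact absurd (hmin w (by simpa using hne)) (not_le.mpr hw)
  have hne : σ w₀ ≠ w₀ := by simpa using hw₀
  -- The rows above `w₀` are fixed, so injectivity of `σ` forbids `σ w₀` to be one of them.
  have hgt : w₀ < σ w₀ := by
    refine lt_of_le_of_ne (not_lt.mp fun h => hne (σ.injective (hfix _ h))) hne.symm
  have hsame : ∀ w < w₀, f' w = f w := fun w hw =>
    Row.emb_injective hQ w (by rw [hf, hf', hfix w hw])
  have hgt0 : (w₀.var (f w₀)).key e < (w₀.var (f' w₀)).key e := by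
    refine (Var.key_lt_key_iff e _ _).mpr (.inr ⟨rfl, rfl, ?_⟩)
    have := hg _ _ ((hlt _ _).mp hgt)
    rwa [← hf, ← hf', w₀.key_emb, w₀.key_emb] at this
  have happ : ∀ (p : (w : Q.Row i) → Q.Col w.origin.1) (u : Q.Var),
      (∑ w : Q.Row i, Finsupp.single (w.var (p w)) 1) u = ∑ w : Q.Row i, if w.var (p w) = u then 1 else 0 := by
    intro p u
    rw [Finsupp.finsetSum_apply]
    exact Finset.sum_congr rfl fun w _ => Finsupp.single_apply
  refine (monomialOrder_lt_iff hQ e).mpr ⟨w₀.var (f w₀), fun u hu => ?_, ?_⟩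
  · rw [happ, happ]
    refine Finset.sum_congr rfl fun w _ => ?_
    rcases lt_trichotomy w w₀ with h | rfl | h
    · rw [hsame w h]
    · rw [if_neg fun h => ?_, if_neg fun h => ?_]
      · rw [← h] at hu; exact lt_irrefl _ hu
      · rw [← h] at hu; exact lt_asymm hu hgt0
    · have h' : ∀ p : (w : Q.Row i) → Q.Col w.origin.1, w.var (p w) ≠ u := fun p hp => by
        rw [← hp] at hu
        exact lt_asymm hu (Row.key_var_lt e ((hlt _ _).mp h) _ _)
      rw [if_neg (h' _), if_neg (h' _)]
  · rw [happ, happ]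
    refine lt_of_eq_of_lt (Finset.sum_eq_zero fun w _ => if_neg fun h => ?_)
      (Finset.sum_pos' (fun _ _ => Nat.zero_le _) ⟨w₀, Finset.mem_univ _, by simp⟩)
    rcases lt_trichotomy w w₀ with h1 | rfl | h1
    · exact (Row.key_var_lt e ((hlt _ _).mp h1) (f' w) (f w₀)).ne (congrArg _ h)
    · exact hgt0.ne (congrArg _ h.symm)
    · exact (Row.key_var_lt e ((hlt _ _).mp h1) (f w₀) (f' w)).ne (congrArg _ h.symm)

/-- A product of entries, one from each row, is zero or a monomial. -/
theorem exists_of_prod_entry_ne_zero [Fintype (Q.Row i)] {g : Q.Row i → Q.Col i}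
    (h : ∏ w, Q.entry w (g w) ≠ 0) :
    ∃ f : (w : Q.Row i) → Q.Col w.origin.1, (∀ w, w.emb (f w) = g w) ∧
      ∏ w, Q.entry w (g w) = monomial (∑ w : Q.Row i, Finsupp.single (w.var (f w)) 1) 1 := by
  have h1 : ∀ w, ∃ c, w.emb c = g w := fun w =>
    exists_emb_of_entry_ne_zero w (g w) (Finset.prod_ne_zero_iff.mp h w (Finset.mem_univ _))
  choose f hf using h1
  refine ⟨f, hf, ?_⟩
  rw [monomial_sum_one]
  exact Finset.prod_congr rfl fun w _ => by rw [← hf w, entry_emb]; rfl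

/-- The initial term of a minor is the product of the diagonal entries. -/
theorem leadingTerm_det [Fintype (Q.Row i)] [DecidableEq (Q.Row i)]
    {g : Q.Row i → Q.Col i} (hg : ∀ w w', w.key e < w'.key e → (g w).key e < (g w').key e)
    {f : (w : Q.Row i) → Q.Col w.origin.1} (hf : ∀ w, w.emb (f w) = g w) :
    (monomialOrder hQ e).leadingTerm (Matrix.of fun w w' => Q.entry w (g w')).det =
      ∏ w : Q.Row i, X (w.var (f w)) := by
  classical
  set p := (Matrix.of fun w w' => Q.entry w (g w')).det with hp
  set d : Q.Var →₀ ℕ := ∑ w : Q.Row i, Finsupp.single (w.var (f w)) 1 with hd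
  have hdet : p = ∑ σ : Equiv.Perm (Q.Row i),
      (Equiv.Perm.sign σ : ℤ) • ∏ w, Q.entry w (g (σ w)) := by
    rw [hp, ← Matrix.det_transpose, Matrix.det_apply]
    rfl
  have hdiag : ∏ w, Q.entry w (g w) = monomial d 1 := by
    rw [hd, monomial_sum_one]
    exact Finset.prod_congr rfl fun w _ => by rw [← hf w, entry_emb]; rfl
  have hcases : ∀ σ : Equiv.Perm (Q.Row i), σ ≠ 1 → ∏ w, Q.entry w (g (σ w)) = 0 ∨
      ∃ d', (monomialOrder hQ e).toSyn d' < (monomialOrder hQ e).toSyn d ∧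
        ∏ w, Q.entry w (g (σ w)) = monomial d' 1 := by
    intro σ hσ
    by_cases h : ∏ w, Q.entry w (g (σ w)) = 0
    · exact .inl h
    · obtain ⟨f', hf', h'⟩ := exists_of_prod_entry_ne_zero h
      exact .inr ⟨_, toSyn_sum_single_lt hQ e hσ hg hf hf', h'⟩
  have hcoeff : coeff d p = 1 := by
    rw [hdet, coeff_sum, Finset.sum_eq_single_of_mem 1 (Finset.mem_univ _)]
    · simp [hdiag]
    · intro σ _ hσ
      rcases hcases σ hσ with h | ⟨d', hd', h⟩
      · simp [h]
      · rw [h, coeff_smul, coeff_monomial, if_neg, smul_zero]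
        rintro rfl
        exact lt_irrefl _ hd'
  have hdeg : (monomialOrder hQ e).degree p = d := by
    refine (monomialOrder hQ e).toSyn.injective (le_antisymm ?_ ?_)
    · rw [MonomialOrder.degree_le_iff]
      intro d₁ hd₁
      rw [hdet] at hd₁
      obtain ⟨σ, -, hσ⟩ := Finset.mem_biUnion.mp (support_sum hd₁)
      have hσ' := support_smul hσ
      by_cases h1 : σ = 1
      · subst h1
        simp only [Equiv.Perm.coe_one, id, hdiag] at hσ'
        rw [Finset.mem_singleton.mp (support_monomial_subset hσ')]
      · rcases hcases σ h1 with h | ⟨d', hd', h⟩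
        · rw [h] at hσ'; simp at hσ'
        · rw [h] at hσ'
          rw [Finset.mem_singleton.mp (support_monomial_subset hσ')]
          exact hd'.le
    · exact MonomialOrder.le_degree (mem_support_iff.mpr (by rw [hcoeff]; exact one_ne_zero))
  rw [MonomialOrder.leadingTerm, MonomialOrder.leadingCoeff, hdeg, hcoeff, hd, monomial_sum_one]
  rfl

include hQ in
-- Since `A i` has exactly `k i` rows, a maximal minor uses every row; numbering rows and columns by
-- the same bijection keeps the sign.
theorem det_mem_minors [Fintype (Q.Row i)] [DecidableEq (Q.Row i)] (hi : i ≠ 0)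
    {g : Q.Row i → Q.Col i} (hg : Function.Injective g) :
    (Matrix.of fun w w' => Q.entry w (g w')).det ∈ Q.minors := by
  have := Row.finite hQ i
  let u : Fin (Q.k i) ≃ Q.Row i := (Finite.equivFinOfCardEq (card_row hQ i hi)).symm
  refine ⟨i, hi, u.toEmbedding, u.toEmbedding.trans ⟨g, hg⟩, ?_⟩
  rw [← Matrix.det_submatrix_equiv_self u]
  rfl

end LeadingTerm

/-! ### Columns of tableaux as initial terms of minors. -/

namespace Tableau

variable {e : Q.BranchNumbering} (T : Tableau e)

theorem len_le_of_reach {v i : Fin (ρ + 1)} (hv : v ≠ 0) (h : Q.Reach v i) :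
    T.len i ≤ T.len v := by
  induction h with
  | refl => exact le_rfl
  | tail h h' ih => exact (T.len_le _ _ (Reach.ne_zero h hv) h').trans ih

/-- The vertex `v` has boxes in the column `q` of the tableau. -/
def Meets (q : ℕ) (v : Fin (ρ + 1)) : Prop :=
  offset e T.len v ≤ q ∧ q < offset e T.len v + T.len v

/-- The witness is the largest vertex meeting the column. Decreasing row lengths and the common
alignment of each branch force all its predecessors `≠ 0` to meet the column, and `len_add_le`
prevents both branches from doing so. -/
theorem exists_meets_iff_reach (hQ : IsYShaped Q) {q : ℕ} (hq : q < T.len 1) :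
    ∃ t, t ≠ 0 ∧ ∀ v, v ≠ 0 → (T.Meets q v ↔ Q.Reach v t) := by
  classical
  have h1 : (1 : Fin (ρ + 1)) ∉ branch e 0 := fun h => lt_irrefl _ (one_lt_of_mem_branch h)
  have h1' : (1 : Fin (ρ + 1)) ∉ branch e 1 := fun h => lt_irrefl _ (one_lt_of_mem_branch h)
  have hM1 : T.Meets q 1 := by simp [Meets, offset, h1, hq]
  obtain ⟨t, ht, hmax⟩ := Finset.exists_max_image
    (Finset.univ.filter fun v => v ≠ 0 ∧ T.Meets q v) id ⟨1, by simp [hQ.one_ne_zero, hM1]⟩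
  obtain ⟨ht0, htq⟩ := (Finset.mem_filter.mp ht).2
  have hmax' : ∀ v, v ≠ 0 → T.Meets q v → v ≤ t := fun v hv hvq => hmax v (by simp [hv, hvq])
  have hsame : ∀ b v, v ≠ 0 → T.Meets q v → v ∈ branch e b → t ∈ branch e b → Q.Reach v t := by
    intro b v hv hvq hvb htb
    rcases reach_total_of_mem_branch hQ hvb htb with h | h
    · exact h
    · rw [le_antisymm (Reach.le h) (hmax' v hv hvq)]
  refine ⟨t, ht0, fun v hv => ⟨fun hvq => ?_, fun hvt => ?_⟩⟩
  · rcases hQ.eq_one_or_one_lt hv with rfl | hv1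
    · exact hQ.reach_one ht0
    rcases hQ.eq_one_or_one_lt ht0 with rfl | ht1
    · exact absurd (hmax' v hv hvq) (not_le.mpr hv1)
    obtain ⟨b, hb⟩ := exists_mem_branch e hQ hv1
    obtain ⟨b', hb'⟩ := exists_mem_branch e hQ ht1
    by_cases hbb : b = b'
    · subst hbb; exact hsame b v hv hvq hb hb'
    exfalso
    have hdisj : ∀ v, v ∈ branch e 1 → v ∉ branch e 0 := fun v h h' =>
      absurd (branch_unique hQ h h') (by decide)
    -- Right-aligned rows start at `len 1 - len v`, which is at least `len t`, where the
    -- left-aligned ones end.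
    have hcontra : ∀ v t, v ∈ branch e 0 → t ∈ branch e 1 → T.Meets q v → T.Meets q t → False := by
      intro v t hv ht hvq htq
      have := T.len_add_le v hv t ht
      rw [Meets, offset, if_pos hv] at hvq
      rw [Meets, offset, if_neg (hdisj t ht)] at htq
      omega
    match b, b', hb, hb', hbb with
    | 0, 0, _, _, h => exact h rfl
    | 0, 1, hb, hb', _ => exact hcontra v t hb hb' hvq htq
    | 1, 0, hb, hb', _ => exact hcontra t v hb' hb htq hvq
    | 1, 1, _, _, h => exact h rfl
  · have hlen := T.len_le_of_reach hv hvt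
    have hlen1 := T.len_le_of_reach hQ.one_ne_zero (hQ.reach_one hv)
    by_cases ht : t ∈ branch e 0
    · rcases eq_one_or_mem_branch_of_reach hQ hv hvt ht with rfl | hv'
      · exact hM1
      · rw [Meets, offset, if_pos ht] at htq
        rw [Meets, offset, if_pos hv']
        omega
    · have hv' : v ∉ branch e 0 := fun h => ht (mem_branch_of_reach h hvt)
      rw [Meets, offset, if_neg ht] at htq
      rw [Meets, offset, if_neg hv']
      omega

open Classical in
/-- The contribution of the box in the row `j` of `i` and the column `q` to the monomial. -/
noncomputable def boxVar (q : ℕ) (i : Fin (ρ + 1)) (j : Fin (Q.s i - Q.r i)) :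
    MvPolynomial Q.Var ℂ :=
  if h : T.Meets q i then
    MvPolynomial.X ⟨i, j, T.fill i j ⟨q - offset e T.len i, by
      have := h.1; have := h.2; omega⟩⟩
  else 1

theorem prod_range_boxVar (hQ : IsYShaped Q) (i : Fin (ρ + 1)) (j : Fin (Q.s i - Q.r i)) :
    ∏ q ∈ Finset.range (T.len 1), T.boxVar q i j =
      ∏ q, MvPolynomial.X ⟨i, j, T.fill i j q⟩ := by
  have hlen := T.len_le_of_reach hQ.one_ne_zero (hQ.reach_one (ne_zero_of_row j))
  have hoff : offset e T.len i + T.len i ≤ T.len 1 := by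
    unfold offset
    split_ifs <;> omega
  symm
  refine Finset.prod_of_injOn (fun q => offset e T.len i + (q : ℕ)) ?_ ?_ ?_ ?_
  · intro q _ q' _ h
    exact Fin.ext (Nat.add_left_cancel h)
  · intro q _
    have := q.2
    simp only [Finset.coe_range, Set.mem_Iio]
    omega
  · intro q _ hq
    refine dif_neg fun h => hq ⟨⟨q - offset e T.len i, ?_⟩, Finset.mem_coe.mpr (Finset.mem_univ _), ?_⟩
    · have := h.1; have := h.2; omega
    · have := h.1
      simp only
      omega
  · intro q _
    have h : T.Meets (offset e T.len i + q) i := ⟨Nat.le_add_right _ _, by have := q.2; omega⟩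
    rw [boxVar, dif_pos h]
    simp

theorem prod_boxVar_eq (hQ : IsYShaped Q) {q : ℕ} {t : Fin (ρ + 1)} [Fintype (Q.Row t)]
    (ht : ∀ v, v ≠ 0 → (T.Meets q v ↔ Q.Reach v t)) :
    ∏ i, ∏ j, T.boxVar q i j = ∏ w : Q.Row t, T.boxVar q w.origin.1 w.origin.2 := by
  rw [← Fintype.prod_sigma' (fun i j => T.boxVar q i j)]
  symm
  refine Finset.prod_of_injOn Row.origin (Row.origin_injective hQ).injOn (fun _ _ => by simp) ?_
    (fun _ _ => rfl)
  rintro ⟨i, j⟩ - h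
  refine dif_neg fun hM => h ?_
  obtain ⟨w, hw⟩ := exists_row_origin_eq ((ht i (ne_zero_of_row j)).mp hM) j
  exact ⟨w, by simp, hw⟩

/-- The monomial of a tableau is a product of initial terms of minors. -/
theorem monomial_mem_adjoin (hQ : IsYShaped Q) :
    T.monomial ∈ Algebra.adjoin ℂ ((monomialOrder hQ e).leadingTerm '' Q.minors) := by
  classical
  -- Regroup the boxes by columns of the tableau instead of rows.
  have hT : T.monomial = ∏ q ∈ Finset.range (T.len 1), ∏ i, ∏ j, T.boxVar q i j := by
    rw [Finset.prod_comm]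
    refine Finset.prod_congr rfl fun i _ => ?_
    exact (Finset.prod_congr rfl fun j _ => (T.prod_range_boxVar hQ i j).symm).trans
      Finset.prod_comm
  rw [hT]
  refine Subalgebra.prod_mem _ fun q hq => Algebra.subset_adjoin ?_
  obtain ⟨t, ht0, ht⟩ := T.exists_meets_iff_reach hQ (Finset.mem_range.mp hq)
  have := Row.finite hQ t
  have := Fintype.ofFinite (Q.Row t)
  have hM : ∀ w : Q.Row t, T.Meets q w.origin.1 := fun w =>
    (ht _ (ne_zero_of_row w.origin.2)).mpr w.reach_origin
  let f : (w : Q.Row t) → Q.Col w.origin.1 := fun w =>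
    T.fill w.origin.1 w.origin.2 ⟨q - offset e T.len w.origin.1, by
      have := (hM w).1; have := (hM w).2; omega⟩
  have hg : ∀ w w' : Q.Row t, w.key e < w'.key e →
      (w.emb (f w)).key e < (w'.emb (f w')).key e := by
    intro w w' hw
    rw [w.key_emb, w'.key_emb]
    refine T.col_strict _ _ _ _ _ _ hw ?_
    have := (hM w).1
    have := (hM w').1
    simp only
    omega
  have hinj : Function.Injective fun w : Q.Row t => w.emb (f w) := by
    intro w w' h
    have h' : (w.emb (f w)).key e = (w'.emb (f w')).key e := congrArg (Col.key e) h
    refine Row.key_injective hQ e ?_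
    rcases lt_trichotomy (w.key e) (w'.key e) with h1 | h1 | h1
    · exact absurd h' (hg _ _ h1).ne
    · exact h1
    · exact absurd h' (hg _ _ h1).ne'
  refine ⟨_, det_mem_minors hQ ht0 hinj, ?_⟩
  rw [leadingTerm_det hQ e hg (fun _ => rfl), T.prod_boxVar_eq hQ ht]
  exact Finset.prod_congr rfl fun w _ => by
    rw [Tableau.boxVar, dif_pos (hM w)]
    rfl

end Tableau

end FlagQuiver

/-! ### Comparing sorted rows by counting. -/

section Sorting

variable {α β : Type*} [Fintype α] [LinearOrder β] {μ : α → ℕ} {L : ℕ}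

/-- The weakly increasing arrangement of a multiset. -/
theorem exists_sorted_equiv {key : α → β} (hk : Function.Injective key) (hL : ∑ c, μ c = L) :
    ∃ s : Fin L ≃ Σ c, Fin (μ c), ∀ q q', q ≤ q' → key (s q).1 ≤ key (s q').1 := by
  let _ : LinearOrder α := LinearOrder.lift' key hk
  have hcard : Fintype.card (Σₗ c, Fin (μ c)) = L := by
    rw [← hL]
    exact (Fintype.card_sigma (α := fun c => Fin (μ c))).trans (by simp)
  let s := Fintype.orderIsoFinOfCardEq (Σₗ c, Fin (μ c)) hcard
  refine ⟨s.toEquiv, fun q q' h => ?_⟩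
  rcases Sigma.lex_iff.mp (s.monotone h) with h1 | ⟨h1, -⟩
  · exact le_of_lt h1
  · exact (congrArg key h1).le

theorem card_filter_sorted_equiv (s : Fin L ≃ Σ c, Fin (μ c)) (p : α → Prop) [DecidablePred p] :
    (Finset.univ.filter fun q => p (s q).1).card = ∑ c, if p c then μ c else 0 := by
  rw [Finset.card_filter, Equiv.sum_comp s (fun x => if p x.1 then 1 else 0), Fintype.sum_sigma]
  refine Finset.sum_congr rfl fun c _ => ?_
  split_ifs <;> simp

/-- Otherwise at most `q` entries of `g` lie below `h q'`, while at least `q' + 1` entries of `h`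
are at most `h q'`. -/
theorem lt_of_card_le_card_left {L L' : ℕ} {g : Fin L → β} {h : Fin L' → β}
    (hg : Monotone g) (hh : Monotone h) {q : Fin L} {q' : Fin L'} (hq : (q : ℕ) = q')
    (hcard : (Finset.univ.filter fun r => h r ≤ h q').card ≤
      (Finset.univ.filter fun r => g r < h q').card) : g q < h q' := by
  by_contra hle
  have h1 : (Finset.univ.filter fun r => g r < h q') ⊆ Finset.Iio q := fun r hr => by
    rw [Finset.mem_Iio]
    by_contra hr'
    exact hle ((hg (not_lt.mp hr')).trans_lt (Finset.mem_filter.mp hr).2)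
  have h2 : Finset.Iic q' ⊆ Finset.univ.filter fun r => h r ≤ h q' := fun r hr => by
    simpa using hh (Finset.mem_Iic.mp hr)
  have h3 := Finset.card_le_card h1
  have h4 := Finset.card_le_card h2
  rw [Fin.card_Iio] at h3
  rw [Fin.card_Iic] at h4
  omega

/-- The mirror image, with positions counted from the right ends of the rows. -/
theorem lt_of_card_le_card_right {L L' : ℕ} {g : Fin L → β} {h : Fin L' → β}
    (hg : Monotone g) (hh : Monotone h) {q : Fin L} {q' : Fin L'} (hq : L - (q : ℕ) = L' - q')
    (hcard : (Finset.univ.filter fun r => g q ≤ g r).card ≤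
      (Finset.univ.filter fun r => g q < h r).card) : g q < h q' := by
  by_contra hle
  have h1 : (Finset.univ.filter fun r => g q < h r) ⊆ Finset.Ioi q' := fun r hr => by
    rw [Finset.mem_Ioi]
    by_contra hr'
    exact hle ((Finset.mem_filter.mp hr).2.trans_le (hh (not_lt.mp hr')))
  have h2 : Finset.Ici q ⊆ Finset.univ.filter fun r => g q ≤ g r := fun r hr => by
    simpa using hg (Finset.mem_Ici.mp hr)
  have h3 := Finset.card_le_card h1
  have h4 := Finset.card_le_card h2
  rw [Fin.card_Ioi] at h3
  rw [Fin.card_Ici] at h4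
  have := q.2
  have := q'.2
  omega

end Sorting

/-! ### Invariance of the minors under row operations. -/

namespace FlagQuiver

open MvPolynomial

variable {ρ : ℕ} {Q : FlagQuiver ρ}

section RowInvariance

theorem Row.entry_eq_X (hQ : IsYShaped Q) {t v : Fin (ρ + 1)} {a : Fin (Q.s v - Q.r v)}
    {w : Q.Row t} (hw : w.origin = ⟨v, a⟩) {c : Q.Col t} {c' : Q.Col v} (hc : c'.start = c.start) :
    Q.entry w c = X ⟨v, a, c'⟩ := by
  have key : ∀ (o : Σ v, Fin (Q.s v - Q.r v)), w.origin = o → ∀ c' : Q.Col o.1,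
      c'.start = c.start → Q.entry w c = X ⟨o.1, o.2, c'⟩ := by
    rintro o rfl c' hc
    rw [← entry_emb, Col.start_injective hQ _ _ ((w.start_emb c').trans hc)]
  exact key _ hw c' hc

theorem Row.entry_eq_zero {t v : Fin (ρ + 1)} {a : Fin (Q.s v - Q.r v)}
    {w : Q.Row t} (hw : w.origin = ⟨v, a⟩) {c : Q.Col t} (hc : ∀ c' : Q.Col v, c'.start ≠ c.start) :
    Q.entry w c = 0 := by
  have key : ∀ (o : Σ v, Fin (Q.s v - Q.r v)), w.origin = o → (∀ c' : Q.Col o.1,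
      c'.start ≠ c.start) → Q.entry w c = 0 := by
    rintro o rfl hc
    by_contra h
    obtain ⟨c', hc'⟩ := exists_emb_of_entry_ne_zero w c h
    exact hc c' (by rw [← w.start_emb, hc'])
  exact key _ hw hc

theorem rowShift_X_of_notMem {N : ℕ} {x y : Fin N → Q.Var} {v : Q.Var} (hv : ¬ ∃ d, y d = v) :
    rowShift ℂ x y (X v) = Polynomial.C (X v) := by
  simp [rowShift, Function.extend_apply' _ _ _ hv]

theorem rowShift_X {N : ℕ} {x y : Fin N → Q.Var} (hy : Function.Injective y) (d : Fin N) :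
    rowShift ℂ x y (X (y d)) =
      Polynomial.C (X (y d)) + Polynomial.X * Polynomial.C (X (x d)) := by
  rw [Polynomial.X_mul]
  simp [rowShift, hy.extend_apply]

variable (hQ : IsYShaped Q) {i j : Fin (ρ + 1)} (p : Fin (Q.s i - Q.r i)) (q : Fin (Q.s j - Q.r j))
  {N : ℕ} (κ : Fin N ≃ Q.Col i) {ε : Q.Col i → Q.Col j} (hε : ∀ c, (ε c).start = c.start)

include hε in
theorem injective_of_start_eq (hQ : IsYShaped Q) : Function.Injective ε := fun c c' h =>
  Col.start_injective hQ c c' (by rw [← hε, h, hε])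

include hQ hε in
theorem target_injective :
    Function.Injective (fun d => (⟨j, q, ε (κ d)⟩ : Q.Var)) := by
  intro d d' h
  simp only [Var.mk.injEq, heq_eq_eq, true_and] at h
  exact κ.injective (injective_of_start_eq hε hQ h)

theorem source_injective : Function.Injective (fun d => (⟨i, p, κ d⟩ : Q.Var)) := by
  intro d d' h
  simp only [Var.mk.injEq, heq_eq_eq, true_and] at h
  exact κ.injective h

theorem Row.rowShift_entry_of_origin_ne {t : Fin (ρ + 1)} {w : Q.Row t} (c : Q.Col t)
    (hw : w.origin ≠ ⟨j, q⟩) :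
    rowShift ℂ (fun d => (⟨i, p, κ d⟩ : Q.Var)) (fun d => ⟨j, q, ε (κ d)⟩) (Q.entry w c) =
      Polynomial.C (Q.entry w c) := by
  by_cases h : Q.entry w c = 0
  · simp [h]
  · obtain ⟨c', rfl⟩ := exists_emb_of_entry_ne_zero w c h
    rw [entry_emb]
    refine rowShift_X_of_notMem fun ⟨d, hd⟩ => hw ?_
    rw [Var.mk.injEq] at hd
    exact Sigma.ext hd.1.symm hd.2.1.symm

include hQ hε in
-- The substitution changes only the variables in columns inherited from `A i`; elsewhere the row
-- `w'` vanishes, so the formula holds there too.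
theorem Row.rowShift_entry {t : Fin (ρ + 1)} {w w' : Q.Row t} (c : Q.Col t)
    (hw : w.origin = ⟨j, q⟩) (hw' : w'.origin = ⟨i, p⟩) :
    rowShift ℂ (fun d => (⟨i, p, κ d⟩ : Q.Var)) (fun d => ⟨j, q, ε (κ d)⟩) (Q.entry w c) =
      Polynomial.C (Q.entry w c) + Polynomial.X * Polynomial.C (Q.entry w' c) := by
  by_cases h : ∃ c' : Q.Col j, c'.start = c.start
  · obtain ⟨c', hc'⟩ := h
    rw [Row.entry_eq_X hQ hw hc']
    by_cases h' : ∃ d, ε (κ d) = c'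
    · obtain ⟨d, rfl⟩ := h'
      rw [hε] at hc'
      rw [Row.entry_eq_X hQ hw' hc']
      exact rowShift_X (target_injective hQ q κ hε) d
    · rw [Row.entry_eq_zero hw', rowShift_X_of_notMem]
      · simp
      · rintro ⟨d, hd⟩
        simp only [Var.mk.injEq, heq_eq_eq, true_and] at hd
        exact h' ⟨d, hd⟩
      · intro c'' hc''
        refine h' ⟨κ.symm c'', ?_⟩
        rw [Equiv.apply_symm_apply]
        exact Col.start_injective hQ _ _ (by rw [hε, hc'', hc'])
  · rw [Row.entry_eq_zero hw fun c' hc' => h ⟨c', hc'⟩, Row.entry_eq_zero hw' fun c' hc' =>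
      h ⟨ε c', by rw [hε, hc']⟩]
    simp

include hQ hε in
/-- The algebra generated by the minors is invariant under adding to the row `(j, q)` multiples
of a row `(i, p)` that belongs to an earlier vertex. -/
theorem rowShift_eq_of_mem_adjoin (hij : Q.Reach i j)
    (hne : (⟨i, p⟩ : Σ v, Fin (Q.s v - Q.r v)) ≠ ⟨j, q⟩) {f : MvPolynomial Q.Var ℂ}
    (hf : f ∈ Algebra.adjoin ℂ Q.minors) :
    rowShift ℂ (fun d => (⟨i, p, κ d⟩ : Q.Var)) (fun d => ⟨j, q, ε (κ d)⟩) f =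
      Polynomial.C f := by
  set φ := rowShift ℂ (fun d => (⟨i, p, κ d⟩ : Q.Var)) (fun d => ⟨j, q, ε (κ d)⟩) with hφ
  induction hf using Algebra.adjoin_induction with
  | algebraMap r => simp [hφ, rowShift, MvPolynomial.algebraMap_eq]
  | add f g _ _ hf hg => rw [map_add, hf, hg, map_add]
  | mul f g _ _ hf hg => rw [map_mul, hf, hg, map_mul]
  | mem f hf =>
    obtain ⟨t, ht, u, v, rfl⟩ := hf
    have hfin := Row.finite hQ t
    have hu : Function.Surjective u := by
      have := Fintype.ofFinite (Q.Row t)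
      refine ((Fintype.bijective_iff_injective_and_card u).mpr ⟨u.injective, ?_⟩).2
      rw [Fintype.card_fin, ← Nat.card_eq_fintype_card, card_row hQ t ht]
    set M := (Q.A t).submatrix u v with hM
    rw [RingHom.map_det]
    have hC : (Polynomial.C M.det : Polynomial (MvPolynomial Q.Var ℂ)) =
        (M.map Polynomial.C).det := by
      rw [RingHom.map_det]
      rfl
    rw [hC]
    -- If `j` reaches `t`, so does `i`, and both rows occur in the minor: this is an elementary row
    -- operation. Otherwise the shifted row does not occur at all.
    by_cases hjt : Q.Reach j t
    · obtain ⟨w, hw⟩ := exists_row_origin_eq hjt q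
      obtain ⟨w', hw'⟩ := exists_row_origin_eq (hij.trans hjt) p
      obtain ⟨a, rfl⟩ := hu w
      obtain ⟨a', rfl⟩ := hu w'
      have haa : a ≠ a' := by
        rintro rfl
        exact hne (hw'.symm.trans hw)
      rw [← Matrix.det_updateRow_add_smul_self (M.map Polynomial.C) haa Polynomial.X]
      congr 1
      ext1 b c
      by_cases hb : b = a
      · subst hb
        rw [Matrix.updateRow_self]
        exact Row.rowShift_entry hQ p q κ hε (v c) hw hw'
      · rw [Matrix.updateRow_ne hb]
        refine Row.rowShift_entry_of_origin_ne p q κ (v c) fun h => hb ?_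
        exact u.injective (Row.origin_injective hQ (h.trans hw.symm))
    · congr 1
      ext1 b c
      refine Row.rowShift_entry_of_origin_ne p q κ (v c) fun h => hjt ?_
      have := (u b).reach_origin
      rwa [h] at this

end RowInvariance

/-! ### The grading by row degrees. -/

section RowDegree

noncomputable instance Var.instFintype : Fintype Q.Var := Fintype.ofFinite _
noncomputable instance Col.instFintype (i : Fin (ρ + 1)) : Fintype (Q.Col i) := Fintype.ofFinite _

variable (Q) in
/-- The weight of a variable is the row to which it belongs. -/
noncomputable def rowWeight (x : Q.Var) : (Σ v, Fin (Q.s v - Q.r v)) → ℕ :=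
  Pi.single ⟨x.vertex, x.row⟩ 1

theorem weight_rowWeight (m : Q.Var →₀ ℕ) (v : Fin (ρ + 1)) (a : Fin (Q.s v - Q.r v)) :
    Finsupp.weight Q.rowWeight m ⟨v, a⟩ = ∑ c, m ⟨v, a, c⟩ := by
  classical
  rw [Finsupp.weight_apply, Finsupp.sum_fintype _ _ (by simp), Finset.sum_apply]
  symm
  refine Finset.sum_of_injOn (fun c => ⟨v, a, c⟩) ?_ (fun _ _ => by simp) ?_ ?_
  · intro c _ c' _ h
    simpa using h
  · rintro ⟨v', a', c'⟩ - h
    rw [Pi.smul_apply, rowWeight, Pi.single_apply, if_neg, smul_zero]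
    intro h'
    obtain ⟨rfl, h2⟩ := Sigma.mk.inj h'
    obtain rfl := eq_of_heq h2
    exact h ⟨c', by simp, rfl⟩
  · intro c _
    simp [rowWeight]

/-- The conditions on the row lengths of a tableau. -/
structure IsShape (e : Q.BranchNumbering) (len : Fin (ρ + 1) → ℕ) : Prop where
  len_le : ∀ i j, i ≠ 0 → 0 < Q.n i j → len j ≤ len i
  len_add_le : ∀ i ∈ branch e 0, ∀ j ∈ branch e 1, len i + len j ≤ len 1

variable (Q) in
/-- The row degree that corresponds to given row lengths. -/
def rowDegree (len : Fin (ρ + 1) → ℕ) (o : Σ v, Fin (Q.s v - Q.r v)) : ℕ := len o.1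

theorem isWeightedHomogeneous_entry {t : Fin (ρ + 1)} (w : Q.Row t) (c : Q.Col t) :
    IsWeightedHomogeneous Q.rowWeight (Q.entry w c) (Pi.single w.origin 1) := by
  by_cases h : Q.entry w c = 0
  · rw [h]
    exact isWeightedHomogeneous_zero _ _ _
  · obtain ⟨c', rfl⟩ := exists_emb_of_entry_ne_zero w c h
    rw [entry_emb]
    exact isWeightedHomogeneous_X _ _ _

theorem exists_isShape_of_mem_minors (hQ : IsYShaped Q) (e : Q.BranchNumbering)
    {f : MvPolynomial Q.Var ℂ} (hf : f ∈ Q.minors) :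
    ∃ len, IsShape e len ∧ IsWeightedHomogeneous Q.rowWeight f (Q.rowDegree len) := by
  classical
  obtain ⟨t, ht, u, v, rfl⟩ := hf
  have hfin := Row.finite hQ t
  have hu : Function.Bijective u := by
    have := Fintype.ofFinite (Q.Row t)
    refine (Fintype.bijective_iff_injective_and_card u).mpr ⟨u.injective, ?_⟩
    rw [Fintype.card_fin, ← Nat.card_eq_fintype_card, card_row hQ t ht]
  -- A minor of `A t` has degree one in each row of `A t`, so its shape is a single column. The two
  -- branches cannot both reach `t`.
  refine ⟨fun v => if v ≠ 0 ∧ Q.Reach v t then 1 else 0, ⟨fun i j hi hij => ?_, ?_⟩, ?_⟩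
  · by_cases h : Q.Reach j t
    · rw [if_pos (⟨hi, .head hij h⟩ : i ≠ 0 ∧ Q.Reach i t)]
      split_ifs <;> omega
    · rw [if_neg fun h' => h h'.2]
      exact Nat.zero_le _
  · intro i hi j hj
    have h1 : ¬ (Q.Reach i t ∧ Q.Reach j t) := fun ⟨h, h'⟩ =>
      absurd (branch_unique hQ (mem_branch_of_reach hi h) (mem_branch_of_reach hj h')) (by decide)
    rw [if_pos (⟨hQ.one_ne_zero, hQ.reach_one ht⟩ : (1 : Fin (ρ + 1)) ≠ 0 ∧ Q.Reach 1 t)]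
    split_ifs with h2 h3
    · exact absurd ⟨h2.2, h3.2⟩ h1
    all_goals omega
  · rw [Matrix.det_apply]
    refine IsWeightedHomogeneous.sum _ _ _ fun σ _ => ?_
    refine Submodule.smul_of_tower_mem (weightedHomogeneousSubmodule ℂ Q.rowWeight _) _ ?_
    rw [mem_weightedHomogeneousSubmodule]
    have h1 := IsWeightedHomogeneous.prod Finset.univ
      (fun a => Q.entry (u (σ a)) (v a)) (fun a => Pi.single (u (σ a)).origin 1)
      fun a _ => isWeightedHomogeneous_entry _ _
    have h2 : ∑ a, (Pi.single (u (σ a)).origin 1 : (Σ v, Fin (Q.s v - Q.r v)) → ℕ) =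
        Q.rowDegree fun v => if v ≠ 0 ∧ Q.Reach v t then 1 else 0 := by
      funext o
      rw [Finset.sum_apply, rowDegree]
      split_ifs with h
      · obtain ⟨w, hw⟩ := exists_row_origin_eq h.2 o.2
        obtain ⟨b, hb⟩ := (hu.comp σ.bijective).2 w
        rw [Finset.sum_eq_single_of_mem b (Finset.mem_univ _)]
        · have hbo : (u (σ b)).origin = o := (congrArg Row.origin hb).trans hw
          rw [hbo, Pi.single_eq_same]
        · intro a _ hab
          refine Pi.single_eq_of_ne (fun h' => hab ?_) _
          refine (hu.comp σ.bijective).1 (Row.origin_injective hQ ?_)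
          rw [hb, hw]
          exact h'.symm
      · refine Finset.sum_eq_zero fun a _ => Pi.single_eq_of_ne (fun h' => h ?_) _
        rw [h']
        exact ⟨ne_zero_of_row (u (σ a)).origin.2, (u (σ a)).reach_origin⟩
    rw [h2] at h1
    exact h1

theorem exists_isShape_of_mem_closure (hQ : IsYShaped Q) (e : Q.BranchNumbering)
    {f : MvPolynomial Q.Var ℂ} (hf : f ∈ Submonoid.closure Q.minors) :
    ∃ len, IsShape e len ∧ IsWeightedHomogeneous Q.rowWeight f (Q.rowDegree len) := by
  induction hf using Submonoid.closure_induction with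
  | mem f hf => exact exists_isShape_of_mem_minors hQ e hf
  | one => exact ⟨0, ⟨fun _ _ _ _ => le_rfl, fun _ _ _ _ => le_rfl⟩, isWeightedHomogeneous_one _ _⟩
  | mul f g _ _ hf hg =>
    obtain ⟨l, hl, hf⟩ := hf
    obtain ⟨l', hl', hg⟩ := hg
    refine ⟨l + l', ⟨fun i j hi hij => add_le_add (hl.1 i j hi hij) (hl'.1 i j hi hij),
      fun i hi j hj => ?_⟩, hf.mul hg⟩
    have := hl.2 i hi j hj
    have := hl'.2 i hi j hj
    simp only [Pi.add_apply]
    omega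

/-- The algebra generated by the minors is graded by row degrees, and the row degrees that occur
are given by row lengths of tableaux. -/
theorem weightedHomogeneousComponent_mem_adjoin (hQ : IsYShaped Q) (e : Q.BranchNumbering)
    {f : MvPolynomial Q.Var ℂ} (hf : f ∈ Algebra.adjoin ℂ Q.minors)
    (δ : (Σ v, Fin (Q.s v - Q.r v)) → ℕ) :
    weightedHomogeneousComponent Q.rowWeight δ f ∈ Algebra.adjoin ℂ Q.minors ∧
      (weightedHomogeneousComponent Q.rowWeight δ f ≠ 0 →
        ∃ len, IsShape e len ∧ δ = Q.rowDegree len) := by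
  classical
  rw [← Subalgebra.mem_toSubmodule, Algebra.adjoin_eq_span] at hf
  induction hf using Submodule.span_induction with
  | mem f hf =>
    obtain ⟨len, hlen, hhom⟩ := exists_isShape_of_mem_closure hQ e hf
    rw [weightedHomogeneousComponent_of_mem hhom]
    split_ifs with h
    · refine ⟨?_, fun _ => ⟨len, hlen, h⟩⟩
      rw [← Subalgebra.mem_toSubmodule, Algebra.adjoin_eq_span]
      exact Submodule.subset_span hf
    · exact ⟨Subalgebra.zero_mem _, fun h' => absurd rfl h'⟩
  | zero => simp
  | add f g _ _ hf hg =>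
    rw [map_add]
    refine ⟨Subalgebra.add_mem _ hf.1 hg.1, fun h => ?_⟩
    by_cases h' : weightedHomogeneousComponent Q.rowWeight δ f = 0
    · rw [h', zero_add] at h
      exact hg.2 h
    · exact hf.2 h'
  | smul r f _ hf =>
    rw [map_smul]
    exact ⟨Subalgebra.smul_mem _ hf.1 r, fun h => hf.2 (right_ne_zero_of_smul h)⟩

end RowDegree

/-! ### Ballot conditions for initial monomials. -/

section Ballot

variable (hQ : IsYShaped Q) (e : Q.BranchNumbering)

include hQ in
theorem exists_col_enumeration (i : Fin (ρ + 1)) : ∃ κ : Fin (Fintype.card (Q.Col i)) ≃ Q.Col i,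
    ∀ c d, (κ c).key e < (κ d).key e ↔ c < d := by
  let _ : LinearOrder (Q.Col i) := LinearOrder.lift' (Col.key e) (Col.key_injective hQ e)
  let κ := Fintype.orderIsoFinOfCardEq (Q.Col i) rfl
  exact ⟨κ.toEquiv, fun c d => κ.lt_iff_lt⟩

variable {e} {i j : Fin (ρ + 1)} {p : Fin (Q.s i - Q.r i)} {q : Fin (Q.s j - Q.r j)}
  {f : MvPolynomial Q.Var ℂ} (hf : f ∈ Algebra.adjoin ℂ Q.minors) {m : Q.Var →₀ ℕ}
  (hm : m ∈ f.support)
  (hmax : ∀ m' ∈ f.support, (monomialOrder hQ e).toSyn m' ≤ (monomialOrder hQ e).toSyn m)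
  (hij : Q.Reach i j)

include hf hm hmax hij in
-- Here the row `(i, p)` has the larger variables. With the merged exponents fixed, a maximal
-- monomial has lexicographically minimal exponents in the row `(j, q)`. The additional columns of
-- `A j` lie to the right and do not enter the count.
theorem ballot_of_lt
    (hpq : (toLex (pos e i, (p : ℕ)) : ℤ ×ₗ ℕ) < toLex (pos e j, (q : ℕ))) (hj : j ∉ branch e 0)
    (d : Q.Col i) :
    (∑ c : Q.Col j, if c.key e ≤ d.key e then m ⟨j, q, c⟩ else 0) ≤
      ∑ c : Q.Col i, if c.key e < d.key e then m ⟨i, p, c⟩ else 0 := by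
  obtain ⟨κ, hκ⟩ := exists_col_enumeration hQ e i
  choose ε hε using fun c : Q.Col i => exists_col_start_eq hij c
  have hεkey : ∀ c, (ε c).key e = c.key e := fun c => by rw [Col.key, Col.key, hε]
  have hκ' : ∀ c d, (κ c).key e ≤ (κ d).key e ↔ c ≤ d := fun c d => by
    rw [← not_lt, hκ, not_lt]
  have hne : (⟨i, p⟩ : Σ v, Fin (Q.s v - Q.r v)) ≠ ⟨j, q⟩ := by
    intro h
    obtain ⟨rfl, h⟩ := Sigma.mk.inj h
    rw [eq_of_heq h] at hpq
    exact lt_irrefl _ hpq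
  have hxlt : ∀ (c : Q.Col i) (c' : Q.Col j),
      (⟨i, p, c⟩ : Q.Var).key e < (⟨j, q, c'⟩ : Q.Var).key e := fun c c' =>
    (Var.key_lt_key_iff e _ _).mpr (.inl hpq)
  have hxx : ∀ c c', (⟨i, p, κ c⟩ : Q.Var).key e < (⟨i, p, κ c'⟩ : Q.Var).key e → c < c' := by
    intro c c' h
    rcases (Var.key_lt_key_iff e _ _).mp h with h | ⟨-, -, h⟩
    · exact absurd h (lt_irrefl _)
    · exact (hκ _ _).mp h
  have key := ballot_of_rowShift_eq_of_min (target_injective hQ q κ hε)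
    (fun c d h => (hxlt (κ c) (ε (κ d))).ne (congrArg _ h)) (source_injective p κ)
    (rowShift_eq_of_mem_adjoin hQ p q κ hε hij hne hf) hm (by
      intro m' hm' h1 h2 c hc
      by_contra hlt
      -- A smaller exponent at `y c` means a larger one at `x c`, and no larger variable has
      -- changed: `m'` would exceed `m`.
      refine absurd (hmax m' hm') (not_le.mpr ((monomialOrder_lt_iff hQ e).mpr
        ⟨⟨i, p, κ c⟩, fun u hu => ?_, ?_⟩))
      · by_cases hux : ∃ d, (⟨i, p, κ d⟩ : Q.Var) = u
        · obtain ⟨d, rfl⟩ := hux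
          have h3 := h2 d
          have h4 := hc d (hxx _ _ hu)
          omega
        · refine (h1 u hux ?_).symm
          rintro ⟨d, rfl⟩
          exact lt_asymm hu (hxlt _ _)
      · have h3 := h2 c
        omega) (κ.symm d)
  have e1 : (∑ c : Q.Col j, if c.key e ≤ d.key e then m ⟨j, q, c⟩ else 0) =
      ∑ b, if b ≤ κ.symm d then m ⟨j, q, ε (κ b)⟩ else 0 := by
    symm
    refine Finset.sum_of_injOn (fun b => ε (κ b))
      ((injective_of_start_eq hε hQ).comp κ.injective).injOn (fun _ _ => by simp) ?_ ?_
    · intro c _ hc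
      refine if_neg (not_le.mpr (Col.lt_key_of_notMem_branch hQ hj hij d c fun c' hc' => hc ?_))
      exact ⟨κ.symm c', by simp, Col.start_injective hQ _ _ (by simp [hε, hc'])⟩
    · intro b _
      simp only [← hκ', Equiv.apply_symm_apply, hεkey]
  have e2 : (∑ c : Q.Col i, if c.key e < d.key e then m ⟨i, p, c⟩ else 0) =
      ∑ b, if b < κ.symm d then m ⟨i, p, κ b⟩ else 0 := by
    rw [← κ.sum_comp]
    simp only [← hκ, Equiv.apply_symm_apply]
  rw [e1, e2]
  exact key

include hf hm hmax hij in
-- The mirror image: now the row `(j, q)` has the larger variables, so its exponents are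
-- lexicographically maximal, and the additional columns of `A j` lie to the left. The homogeneity
-- required for maxima comes from the row degree.
theorem ballot_of_gt {δ : (Σ v, Fin (Q.s v - Q.r v)) → ℕ}
    (hδ : ∀ m' ∈ f.support, Finsupp.weight Q.rowWeight m' = δ)
    (hpq : (toLex (pos e j, (q : ℕ)) : ℤ ×ₗ ℕ) < toLex (pos e i, (p : ℕ))) (hj : j ∈ branch e 0)
    (d : Q.Col i) :
    (∑ c : Q.Col j, if d.key e ≤ c.key e then m ⟨j, q, c⟩ else 0) ≤
      ∑ c : Q.Col i, if d.key e < c.key e then m ⟨i, p, c⟩ else 0 := by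
  classical
  obtain ⟨κ, hκ⟩ := exists_col_enumeration hQ e i
  choose ε hε using fun c : Q.Col i => exists_col_start_eq hij c
  have hεkey : ∀ c, (ε c).key e = c.key e := fun c => by rw [Col.key, Col.key, hε]
  have hεinj := (injective_of_start_eq hε hQ).comp κ.injective
  have hκ' : ∀ c d, (κ c).key e ≤ (κ d).key e ↔ c ≤ d := fun c d => by
    rw [← not_lt, hκ, not_lt]
  have hne : (⟨i, p⟩ : Σ v, Fin (Q.s v - Q.r v)) ≠ ⟨j, q⟩ := by
    intro h
    obtain ⟨rfl, h⟩ := Sigma.mk.inj h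
    rw [eq_of_heq h] at hpq
    exact lt_irrefl _ hpq
  have hxlt : ∀ (c : Q.Col i) (c' : Q.Col j),
      (⟨j, q, c'⟩ : Q.Var).key e < (⟨i, p, c⟩ : Q.Var).key e := fun c c' =>
    (Var.key_lt_key_iff e _ _).mpr (.inl hpq)
  have hyy : ∀ c c', (⟨j, q, ε (κ c)⟩ : Q.Var).key e < (⟨j, q, ε (κ c')⟩ : Q.Var).key e →
      c < c' := by
    intro c c' h
    rcases (Var.key_lt_key_iff e _ _).mp h with h | ⟨-, -, h⟩
    · exact absurd h (lt_irrefl _)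
    · simp only [hεkey] at h
      exact (hκ _ _).mp h
  have hsplit : ∀ m' : Q.Var →₀ ℕ, ∑ c : Q.Col j, m' ⟨j, q, c⟩ =
      ∑ b, m' ⟨j, q, ε (κ b)⟩ +
        ∑ c ∈ Finset.univ.filter fun c : Q.Col j => ¬ ∃ b, ε (κ b) = c, m' ⟨j, q, c⟩ := by
    intro m'
    rw [← Finset.sum_filter_add_sum_filter_not Finset.univ fun c : Q.Col j => ∃ b, ε (κ b) = c]
    congr 1
    symm
    refine Finset.sum_of_injOn (fun b => ε (κ b)) hεinj.injOn (fun b _ => by simp) ?_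
      (fun _ _ => rfl)
    intro c hc h
    obtain ⟨b, hb⟩ := (Finset.mem_filter.mp hc).2
    exact absurd ⟨b, by simp, hb⟩ h
  have key := ballot_of_rowShift_eq_of_max (target_injective hQ q κ hε)
    (fun c d h => (hxlt (κ c) (ε (κ d))).ne (congrArg _ h).symm) (source_injective p κ)
    (rowShift_eq_of_mem_adjoin hQ p q κ hε hij hne hf) hm (by
      intro m' hm' h1
      have h2 := congrFun ((hδ m' hm').trans (hδ m hm).symm) ⟨j, q⟩
      rw [weight_rowWeight, weight_rowWeight, hsplit, hsplit] at h2
      have h3 : ∑ c ∈ Finset.univ.filter fun c : Q.Col j => ¬ ∃ b, ε (κ b) = c, m' ⟨j, q, c⟩ =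
          ∑ c ∈ Finset.univ.filter fun c : Q.Col j => ¬ ∃ b, ε (κ b) = c, m ⟨j, q, c⟩ := by
        refine Finset.sum_congr rfl fun c hc => h1 _ ?_ ?_
        · rintro ⟨b, hb⟩
          exact (hxlt (κ b) c).ne (congrArg _ hb.symm)
        · rintro ⟨b, hb⟩
          simp only [Var.mk.injEq, heq_eq_eq, true_and] at hb
          exact (Finset.mem_filter.mp hc).2 ⟨b, hb⟩
      rw [h3] at h2
      exact Nat.add_right_cancel h2) (by
      intro m' hm' h1 h2 c hc
      by_contra hlt
      refine absurd (hmax m' hm') (not_le.mpr ((monomialOrder_lt_iff hQ e).mpr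
        ⟨⟨j, q, ε (κ c)⟩, fun u hu => ?_, not_le.mp hlt⟩))
      by_cases huy : ∃ d, (⟨j, q, ε (κ d)⟩ : Q.Var) = u
      · obtain ⟨d, rfl⟩ := huy
        exact (hc d (hyy _ _ hu)).symm
      · refine (h1 u ?_ huy).symm
        rintro ⟨d, rfl⟩
        exact lt_asymm hu (hxlt _ _)) (κ.symm d)
  have e1 : (∑ c : Q.Col j, if d.key e ≤ c.key e then m ⟨j, q, c⟩ else 0) =
      ∑ b, if κ.symm d ≤ b then m ⟨j, q, ε (κ b)⟩ else 0 := by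
    symm
    refine Finset.sum_of_injOn (fun b => ε (κ b)) hεinj.injOn (fun _ _ => by simp) ?_ ?_
    · intro c _ hc
      refine if_neg (not_le.mpr (Col.key_lt_of_mem_branch hQ hj hij d c fun c' hc' => hc ?_))
      exact ⟨κ.symm c', by simp, Col.start_injective hQ _ _ (by simp [hε, hc'])⟩
    · intro b _
      simp only [← hκ', Equiv.apply_symm_apply, hεkey]
  have e2 : (∑ c : Q.Col i, if d.key e < c.key e then m ⟨i, p, c⟩ else 0) =
      ∑ b, if κ.symm d < b then m ⟨i, p, κ b⟩ else 0 := by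
    rw [← κ.sum_comp]
    simp only [← hκ, Equiv.apply_symm_apply]
  rw [e1, e2]
  exact key

end Ballot

end FlagQuiver

/-! ### Initial monomials are tableau monomials. -/

namespace FlagQuiver

open MvPolynomial

variable {ρ : ℕ} {Q : FlagQuiver ρ} (hQ : IsYShaped Q) {e : Q.BranchNumbering}

theorem IsShape.len_le_of_reach {len : Fin (ρ + 1) → ℕ} (h : IsShape e len) {v i : Fin (ρ + 1)}
    (hv : v ≠ 0) (hvi : Q.Reach v i) : len i ≤ len v := by
  induction hvi with
  | refl => exact le_rfl
  | tail h1 h2 ih => exact (h.len_le _ _ (Reach.ne_zero h1 hv) h2).trans ih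

include hQ in
theorem IsShape.len_le_one {len : Fin (ρ + 1) → ℕ} (h : IsShape e len) {v : Fin (ρ + 1)}
    (hv : v ≠ 0) : len v ≤ len 1 :=
  h.len_le_of_reach hQ.one_ne_zero (hQ.reach_one hv)

section

variable {f : MvPolynomial Q.Var ℂ} (hf : f ∈ Algebra.adjoin ℂ Q.minors) {m : Q.Var →₀ ℕ}
  (hm : m ∈ f.support)
  (hmax : ∀ m' ∈ f.support, (monomialOrder hQ e).toSyn m' ≤ (monomialOrder hQ e).toSyn m)
  {len : Fin (ρ + 1) → ℕ} (hlen : IsShape e len)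
  (hδ : ∀ m' ∈ f.support, Finsupp.weight Q.rowWeight m' = Q.rowDegree len)

include hf hm hmax hlen hδ

/-- The initial monomial of a row-homogeneous element of the algebra generated by the minors is the
monomial of a tableau: sorting its rows gives strictly increasing columns. -/
theorem exists_tableau_of_row_homogeneous :
    ∃ T : Tableau e, T.monomial = MvPolynomial.monomial m 1 := by
  classical
  have hrow : ∀ (i : Fin (ρ + 1)) (j : Fin (Q.s i - Q.r i)), ∑ c, m ⟨i, j, c⟩ = len i :=
    fun i j => by rw [← weight_rowWeight, hδ m hm]; rfl
  choose s hs using fun (i : Fin (ρ + 1)) (j : Fin (Q.s i - Q.r i)) =>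
    exists_sorted_equiv (key := fun c : Q.Col i => c.key e) (μ := fun c => m ⟨i, j, c⟩)
      (Col.key_injective hQ e) (hrow i j)
  have hmono : ∀ i j, Monotone fun q => (s i j q).1.key e := fun i j q q' h => hs i j q q' h
  have hstrict : ∀ i (j : Fin (Q.s i - Q.r i)) (q : Fin (len i))
      i' (j' : Fin (Q.s i' - Q.r i')) (q' : Fin (len i')),
      (toLex (pos e i, (j : ℕ)) : ℤ ×ₗ ℕ) < toLex (pos e i', (j' : ℕ)) →
      offset e len i + (q : ℕ) = offset e len i' + (q' : ℕ) →
      (s i j q).1.key e < (s i' j' q').1.key e := by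
    intro i j q i' j' q' hlt hoff
    have hi0 := ne_zero_of_row j
    have hi0' := ne_zero_of_row j'
    have hple : pos e i ≤ pos e i' := by
      rcases Prod.Lex.toLex_lt_toLex.mp hlt with h | ⟨h, -⟩
      · exact h.le
      · exact h.le
    have hle := hlen.len_le_one hQ hi0
    have hle' := hlen.len_le_one hQ hi0'
    have hq := q.2
    have hq' := q'.2
    by_cases hi : i ∈ branch e 0
    · by_cases hi' : i' ∈ branch e 1
      · have h0 : i' ∉ branch e 0 := fun h => absurd (branch_unique hQ h hi') (by decide)
        have := hlen.len_add_le i hi i' hi'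
        rw [offset, offset, if_pos hi, if_neg h0] at hoff
        omega
      · have hreach := reach_of_pos_le_of_mem hQ hi hi0' hi' hple
        -- The formula also covers `i' = 1`, whose rows are aligned on both sides.
        have hoff' : offset e len i' = len 1 - len i' := by
          rw [offset]
          split_ifs with h0
          · rfl
          · rcases eq_one_or_mem_branch_one hQ hi0' h0 with rfl | h1
            · simp
            · exact absurd h1 hi'
        rw [hoff', offset, if_pos hi] at hoff
        -- An entry that is not a column of `A i'` lies to the left of all columns of `A i'`, so the
        -- ballot condition is needed only for shared columns.
        by_cases hc : ∃ d : Q.Col i', d.start = (s i j q).1.start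
        · obtain ⟨d, hd⟩ := hc
          have hkey : d.key e = (s i j q).1.key e := by rw [Col.key, Col.key, hd]
          have hb := ballot_of_gt (p := j') (q := j) hQ hf hm hmax hreach hδ hlt hi d
          rw [hkey, ← card_filter_sorted_equiv (s i j) fun c => (s i j q).1.key e ≤ c.key e,
            ← card_filter_sorted_equiv (s i' j') fun c => (s i j q).1.key e < c.key e] at hb
          exact lt_of_card_le_card_right (hmono i j) (hmono i' j') (by omega) hb
        · exact Col.key_lt_of_mem_branch hQ hi hreach _ _ fun d hd => hc ⟨d, hd⟩
    · obtain ⟨hi', hreach⟩ := reach_of_pos_le_of_notMem hQ hi hi0 hple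
      rw [offset, offset, if_neg hi, if_neg hi'] at hoff
      by_cases hc : ∃ d : Q.Col i, d.start = (s i' j' q').1.start
      · obtain ⟨d, hd⟩ := hc
        have hkey : d.key e = (s i' j' q').1.key e := by rw [Col.key, Col.key, hd]
        have hb := ballot_of_lt (p := j) (q := j') hQ hf hm hmax hreach hlt hi' d
        rw [hkey, ← card_filter_sorted_equiv (s i' j') fun c => c.key e ≤ (s i' j' q').1.key e,
          ← card_filter_sorted_equiv (s i j) fun c => c.key e < (s i' j' q').1.key e] at hb
        exact lt_of_card_le_card_left (hmono i j) (hmono i' j') (by omega) hb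
      · exact Col.lt_key_of_notMem_branch hQ hi' hreach _ _ fun d hd => hc ⟨d, hd⟩
  refine ⟨⟨len, hlen.len_le, hlen.len_add_le, fun i j q => (s i j q).1, hs, hstrict⟩, ?_⟩
  have h1 : ∀ (i : Fin (ρ + 1)) (j : Fin (Q.s i - Q.r i)),
      ∏ q, (X ⟨i, j, (s i j q).1⟩ : MvPolynomial Q.Var ℂ) =
        ∏ c, X ⟨i, j, c⟩ ^ m ⟨i, j, c⟩ := by
    intro i j
    rw [Equiv.prod_comp (s i j) (fun x => (X ⟨i, j, x.1⟩ : MvPolynomial Q.Var ℂ)),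
      Fintype.prod_sigma]
    simp
  have h2 : (MvPolynomial.monomial m 1 : MvPolynomial Q.Var ℂ) = ∏ v, X v ^ m v := by
    rw [monomial_eq, C_1, one_mul, Finsupp.prod_fintype _ _ (by simp)]
  let E : Q.Var ≃ Σ i, Σ _ : Fin (Q.s i - Q.r i), Q.Col i :=
    ⟨fun v => ⟨v.vertex, v.row, v.col⟩, fun p => ⟨p.1, p.2.1, p.2.2⟩, fun _ => rfl, fun _ => rfl⟩
  rw [h2, ← E.symm.prod_comp, Fintype.prod_sigma]
  refine Finset.prod_congr rfl fun i _ => ?_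
  rw [Fintype.prod_sigma]
  exact Finset.prod_congr rfl fun j _ => h1 i j

end

/-- The initial monomial of an element of the algebra generated by the minors is the monomial of a
tableau. -/
theorem exists_tableau_monomial_eq {f : MvPolynomial Q.Var ℂ}
    (hf : f ∈ Algebra.adjoin ℂ Q.minors) (hf0 : f ≠ 0) :
    ∃ T : Tableau e, T.monomial = MvPolynomial.monomial ((monomialOrder hQ e).degree f) 1 := by
  classical
  set m := (monomialOrder hQ e).degree f with hm
  have hmf : m ∈ f.support := MonomialOrder.degree_mem_support hf0
  -- The row-homogeneous component containing `m` stays in the algebra and keeps `m` as its largest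
  -- monomial.
  obtain ⟨h1, h2⟩ := weightedHomogeneousComponent_mem_adjoin hQ e hf
    (Finsupp.weight Q.rowWeight m)
  have h3 : m ∈ (weightedHomogeneousComponent Q.rowWeight
      (Finsupp.weight Q.rowWeight m) f).support := by
    rw [support_weightedHomogeneousComponent]
    exact Finset.mem_filter.mpr ⟨hmf, rfl⟩
  obtain ⟨len, hlen, hδ⟩ := h2 fun h => by rw [h] at h3; simp at h3
  refine exists_tableau_of_row_homogeneous hQ h1 h3 (fun m' hm' => ?_) hlen (fun m' hm' => ?_)
  · rw [support_weightedHomogeneousComponent] at hm'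
    exact MonomialOrder.le_degree (Finset.mem_filter.mp hm').1
  · rw [support_weightedHomogeneousComponent] at hm'
    exact (Finset.mem_filter.mp hm').2.trans hδ

variable (e) in
-- Initial terms are multiplicative, so the initial algebra is spanned by the initial terms
-- themselves, each a scalar multiple of a tableau monomial.
theorem initialAlgebra_le_span :
    (initialAlgebra (monomialOrder hQ e) (Algebra.adjoin ℂ Q.minors)).toSubmodule ≤
      Submodule.span ℂ (Set.range fun T : Tableau e => T.monomial) := by
  have hclosure : ∀ g ∈ Submonoid.closure ((monomialOrder hQ e).leadingTerm ''
      (Algebra.adjoin ℂ Q.minors : Set (MvPolynomial Q.Var ℂ))),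
      ∃ f ∈ Algebra.adjoin ℂ Q.minors, (monomialOrder hQ e).leadingTerm f = g := by
    intro g hg
    induction hg using Submonoid.closure_induction with
    | mem g hg => exact hg
    | one =>
      refine ⟨1, Subalgebra.one_mem _, ?_⟩
      rw [← C_1]
      exact MonomialOrder.leadingTerm_C _
    | mul g g' _ _ hg hg' =>
      obtain ⟨f, hf, rfl⟩ := hg
      obtain ⟨f', hf', rfl⟩ := hg'
      exact ⟨f * f', Subalgebra.mul_mem _ hf hf', MonomialOrder.leadingTerm_mul _ _⟩
  rw [initialAlgebra, Algebra.adjoin_eq_span, Submodule.span_le]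
  intro g hg
  obtain ⟨f, hf, rfl⟩ := hclosure g hg
  by_cases hf0 : f = 0
  · rw [hf0, MonomialOrder.leadingTerm_zero]
    exact Submodule.zero_mem _
  obtain ⟨T, hT⟩ := exists_tableau_monomial_eq (e := e) hQ hf hf0
  have : (monomialOrder hQ e).leadingTerm f =
      (monomialOrder hQ e).leadingCoeff f • T.monomial := by
    rw [hT, smul_monomial, smul_eq_mul, mul_one]
    rfl
  rw [this]
  exact Submodule.smul_mem _ _ (Submodule.subset_span ⟨T, rfl⟩)

end FlagQuiver

theorem mainTheorem2 {ρ : ℕ} (Q : FlagQuiver ρ) (hQ : Q.IsYShaped) (e : Q.BranchNumbering) :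
    IsSagbiBasis (FlagQuiver.monomialOrder hQ e) Q.minors (Algebra.adjoin ℂ Q.minors) ∧
    (initialAlgebra (FlagQuiver.monomialOrder hQ e) (Algebra.adjoin ℂ Q.minors)).toSubmodule =
      Submodule.span ℂ (Set.range fun T : FlagQuiver.Tableau e => T.monomial) := by
  have h1 : Algebra.adjoin ℂ ((FlagQuiver.monomialOrder hQ e).leadingTerm '' Q.minors) ≤
      initialAlgebra (FlagQuiver.monomialOrder hQ e) (Algebra.adjoin ℂ Q.minors) :=
    Algebra.adjoin_mono (Set.image_mono Algebra.subset_adjoin)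
  have h2 := FlagQuiver.initialAlgebra_le_span hQ e
  have h3 : Submodule.span ℂ (Set.range fun T : FlagQuiver.Tableau e => T.monomial) ≤
      (Algebra.adjoin ℂ
        ((FlagQuiver.monomialOrder hQ e).leadingTerm '' Q.minors)).toSubmodule := by
    rw [Submodule.span_le]
    rintro _ ⟨T, rfl⟩
    exact T.monomial_mem_adjoin hQ
  exact ⟨⟨Algebra.subset_adjoin, le_antisymm h1 fun f hf => h3 (h2 hf)⟩,
    le_antisymm h2 fun f hf => h1 (h3 hf)⟩
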